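/- Let $d\ge 2$ and write $\mathbb R^{2d-1}=\mathbb R^{d-1}\times\mathbb R\times\mathbb R^{d-1}$ with coordinates $(z_0,z_1,z_2)$ and the Euclidean metric. Fix $z_2^*\in\mathbb R^{d-1}\setminus\{0\}$ and let $$K_0=\{(z_0,z_1,0): |z_0|^2+z_1^2=1\},\quad K_1=\{(0,z_1+1,z_2): z_1^2+|z_2|^2=1\},\quad K_2=\{(z_0,z_1,z_2^*): |z_0|^2+z_1^2=1\},$$ so that $K_0\cup K_1$ is a higher-dimensional Hopf link and $K_0\cup K_2$ an unlink of two $(d-1)$-spheres. Identify $T^*\mathbb R^{2d-1}$ with $\mathbb R^{2d-1}\times\mathbb R^{2d-1}$ by the metric, and let $UT^*\mathbb R^{2d-1}=\{(q,p): |p|=1\}$. For a submanifold $K\subset\mathbb R^{2d-1}$ let $L_K=\{(q,p): q\in K,\ p\perp T_qK\}$ be its conormal bundle and $\Lambda_K=L_K\cap UT^*\mathbb R^{2d-1}$ its unit conormal bundle. A spin structure on a manifold of dimension at least $2$ means an orientation together with a double covering of the bundle of positively oriented tangent frames which is non-trivial over each fibre. Fix a spin structure on $\mathbb R^{2d-1}$.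 It induces a spin structure on $\Lambda_K$ as follows: the isomorphisms $T_{(q,p)}L_K\to T_qK\oplus (T_qK)^\perp=T_q\mathbb R^{2d-1}$, $(v,w)\mapsto v+\mathrm{pr}_{(T_qK)^\perp}w$, which for $p=0$ are the canonical identification along the zero section, pull it back to a spin structure on $TL_K$; and $\Lambda_K$ carries the spin structure whose stabilization is the restriction of the latter to $TL_K|_{\Lambda_K}=\underline{\mathbb R}\oplus T\Lambda_K$, where $\underline{\mathbb R}$ is spanned by the radial vector $(0,p)$, placed first. Then $\Lambda_{K_0\cup K_1}$ and $\Lambda_{K_0\cup K_2}$ are smooth $(2d-2)$-dimensional submanifolds, the structures just described are spin structures on them, and with these spin structures they are isotopic as smooth submanifolds of $UT^*\mathbb R^{2d-1}$: there is a smooth family of embeddings $F_s\colon\Lambda_{K_0\cup K_1}\to UT^*\mathbb R^{2d-1}$, $s\in[0,1]$, such that $F_0$ is the inclusion and $F_1$ is a diffeomorphism onto $\Lambda_{K_0\cup K_2}$ whose differential lifts to an isomorphism of the two spin structures. -/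

import Mathlib

open Set
open scoped ContDiff InnerProductSpace

namespace ConormalSpin

section Submanifolds

variable {V W : Type} [NormedAddCommGroup V] [NormedSpace ℝ V]
  [NormedAddCommGroup W] [NormedSpace ℝ W]

/-- The tangent space of `S ⊆ V` at `x`. For an embedded smooth submanifold the tangent cone is
already a linear subspace, the usual tangent space, and the span adds nothing. -/
def tangentSpace (S : Set V) (x : V) : Submodule ℝ V :=
  Submodule.span ℝ (tangentConeAt ℝ S x)

/-- `f` restricts to a smooth embedding of `S`: it is smooth on `S` and has a smooth inverse
`f(S) → S`. (For a submanifold `S`, differentiating `g ∘ f = id` shows that this is an immersion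
which is a homeomorphism onto its image, and conversely.) -/
def IsSmoothEmbeddingOn (f : V → W) (S : Set V) : Prop :=
  ContDiffOn ℝ ∞ f S ∧ ∃ g : W → V, ContDiffOn ℝ ∞ g (f '' S) ∧ LeftInvOn g f S

/-- `S` is an embedded smooth `k`-dimensional submanifold of `V`: every point of `S` has a
neighbourhood in `S` that is diffeomorphic to an open subset of `ℝ^k`. -/
def IsSmoothSubmanifold (k : ℕ) (S : Set V) : Prop :=
  ∀ x ∈ S, ∃ U : Set V, IsOpen U ∧ x ∈ U ∧
    ∃ O : Set (EuclideanSpace ℝ (Fin k)), IsOpen O ∧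
      ∃ φ : EuclideanSpace ℝ (Fin k) → V, IsSmoothEmbeddingOn φ O ∧ φ '' O = S ∩ U

/-- The total space of the bundle of linear frames of the tangent bundle of a `k`-dimensional
submanifold `S`, as a subspace of `V × V^k`. -/
def frameBundle (S : Set V) (k : ℕ) : Set (V × (Fin k → V)) :=
  {a | a.1 ∈ S ∧ LinearIndependent ℝ a.2 ∧ Submodule.span ℝ (range a.2) = tangentSpace S a.1}

/-- The rotation by the angle `θ` of the `i`-th and `j`-th vectors of the frame `f`. -/
noncomputable def rotateFrame {k : ℕ} (i j : Fin k) (θ : ℝ) (f : Fin k → V) : Fin k → V :=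
  Function.update (Function.update f i (Real.cos θ • f i + Real.sin θ • f j))
    j (-Real.sin θ • f i + Real.cos θ • f j)

end Submanifolds

universe u

/-- A topological space with a map to the space of `k`-frames in `V`. -/
structure FrameCover (V : Type) (k : ℕ) where
  /-- the total space -/
  carrier : Type u
  /-- its topology -/
  [top : TopologicalSpace carrier]
  /-- the projection -/
  proj : carrier → V × (Fin k → V)

attribute [instance] FrameCover.top

section Spin

variable {V W : Type} [NormedAddCommGroup V] [NormedSpace ℝ V]
  [NormedAddCommGroup W] [NormedSpace ℝ W]

/-- The pullback (fibre product) of `σ` along a map `φ` of frames defined on `A`. -/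
def FrameCover.pullback {k l : ℕ} (σ : FrameCover.{u} V k) (A : Set (W × (Fin l → W)))
    (φ : W × (Fin l → W) → V × (Fin k → V)) : FrameCover.{u} W l where
  carrier := {y : σ.carrier × (W × (Fin l → W)) // y.2 ∈ A ∧ σ.proj y.1 = φ y.2}
  proj := fun y => y.1.2

/-- Spin structures on (the tangent bundle of) a `k`-dimensional submanifold `S`, `k ≥ 2`:
an orientation of `S` together with a double covering of the bundle of positive frames whose
restriction to each fibre is non-trivial. The positive frames are the image of the projection.
The fibre of the bundle of positive frames is a copy of `GL⁺(k)`, whose fundamental group is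
generated by the loop that rotates two of the frame vectors once; hence the covering is
non-trivial on the fibre if and only if this loop does not lift to a closed loop. -/
structure IsSpinStructure {k : ℕ} (S : Set V) (σ : FrameCover.{u} V k) : Prop where
  proj_mem : ∀ y, σ.proj y ∈ frameBundle S k
  /-- over each point of `S`, the image is exactly one of the two orientation classes -/
  orientation : ∀ (x : V) (f : Fin k → V) (g : Matrix (Fin k) (Fin k) ℝ),
    (x, f) ∈ frameBundle S k → g.det ≠ 0 →
      ((x, fun j => ∑ i, g i j • f i) ∈ range σ.proj ↔ ((x, f) ∈ range σ.proj ↔ 0 < g.det))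
  /-- the orientation varies continuously -/
  isOpen_positive : IsOpen {a : frameBundle S k | (a : V × (Fin k → V)) ∈ range σ.proj}
  isCoveringMap : IsCoveringMap (rangeFactorization σ.proj)
  two_sheeted : ∀ a ∈ range σ.proj, (σ.proj ⁻¹' {a}).ncard = 2
  nontrivial_on_fibres : ∀ (i j : Fin k), i ≠ j → ∀ γ : C(unitInterval, σ.carrier),
    (∀ t : unitInterval, σ.proj (γ t) =
      ((σ.proj (γ 0)).1, rotateFrame i j (2 * Real.pi * t) (σ.proj (γ 0)).2)) →
    γ 1 ≠ γ 0

/-- `S₀` and `S₁`, with the spin structures `σ₀` and `σ₁`, are isotopic as smooth submanifolds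
of `N ⊆ V` with spin structures: there is a smooth family of embeddings `F s : S₀ → N`,
`s ∈ [0,1]`, from the inclusion to a diffeomorphism `S₀ → S₁` whose differential on frames is
covered by an isomorphism of `σ₀` with `σ₁` (that is, transporting `σ₀` along the isotopy
gives `σ₁`). On vectors tangent to `S₀`, `fderivWithin ℝ (F 1) S₀ x` is the differential
of the map `F 1` of the submanifold `S₀`. -/
def SpinIsotopic {k : ℕ} (N S₀ S₁ : Set V) (σ₀ σ₁ : FrameCover.{u} V k) : Prop :=
  ∃ F : ℝ → V → V,
    ContDiffOn ℝ ∞ (Function.uncurry F) (Icc (0 : ℝ) 1 ×ˢ S₀) ∧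
    (∀ s ∈ Icc (0 : ℝ) 1, IsSmoothEmbeddingOn (F s) S₀ ∧ MapsTo (F s) S₀ N) ∧
    (∀ x ∈ S₀, F 0 x = x) ∧
    F 1 '' S₀ = S₁ ∧
    ∃ Φ : σ₀.carrier ≃ₜ σ₁.carrier, ∀ y,
      σ₁.proj (Φ y) = (F 1 (σ₀.proj y).1,
        fun i => fderivWithin ℝ (F 1) S₀ (σ₀.proj y).1 ((σ₀.proj y).2 i))

end Spin

section Conormal

variable {V : Type} [NormedAddCommGroup V] [InnerProductSpace ℝ V] [FiniteDimensional ℝ V]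

/-- The unit cotangent bundle of the Euclidean space `V`, with `T^*V` identified with
`TV = V × V` by the metric. -/
def unitCotangent (V : Type) [NormedAddCommGroup V] : Set (V × V) := {x | ‖x.2‖ = 1}

/-- The conormal bundle `L_K`. -/
def conormal (K : Set V) : Set (V × V) :=
  {x | x.1 ∈ K ∧ ∀ v ∈ tangentSpace K x.1, ⟪x.2, v⟫_ℝ = 0}

/-- The unit conormal bundle `Λ_K`. -/
def unitConormal (K : Set V) : Set (V × V) := conormal K ∩ unitCotangent V

/-- At a point `x = (q, p)` of `L_K`, the isomorphism of `T_x L_K` with `T_q V = V` that maps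
`(v, w)` to the sum of `v` (in `T_q K`) and the component of `w` in `(T_q K)^⊥`. For `p = 0` it is
the identification `T_(q,0) L_K = T_q K ⊕ (T_q K)^⊥ = T_q V`. -/
noncomputable def conormalIso (K : Set V) (x : V × V) : V × V →ₗ[ℝ] V :=
  LinearMap.fst ℝ V V +
    (((tangentSpace K x.1)ᗮ).starProjection : V →ₗ[ℝ] V) ∘ₗ LinearMap.snd ℝ V V

/-- The spin structure on `T L_K` that extends the one on `T L_K|_K ≅ TV|_K` induced by the spin
structure `σ` on `V`: the pullback of `σ` by the bundle isomorphisms `conormalIso`. -/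
noncomputable def conormalCover {k : ℕ} (σ : FrameCover.{u} V k) (K : Set V) :
    FrameCover.{u} (V × V) k :=
  σ.pullback (frameBundle (conormal K) k) fun a => (a.1.1, fun i => conormalIso K a.1 (a.2 i))

/-- The spin structure on `Λ_K`: along `Λ_K` one has `T L_K = ℝ ⊕ T Λ_K`, where the line is
spanned by the radial vector `(0, p)` at `(q, p)`, and the spin structure on `T Λ_K` is the one
whose stabilization is the spin structure on `T L_K`; so its positive frames and their
lifts are those of the stabilized frames. -/
noncomputable def unitConormalCover {k : ℕ} (σ : FrameCover.{u} V (k + 1)) (K : Set V) :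
    FrameCover.{u} (V × V) k :=
  (conormalCover σ K).pullback (frameBundle (unitConormal K) k)
    fun a => (a.1, Fin.cons (0, a.1.2) a.2)

end Conormal

section Spheres

/-- `ℝ^(2d-1) = ℝ^(d-1) × ℝ × ℝ^(d-1)` with the Euclidean metric. -/
abbrev Space (d : ℕ) : Type := EuclideanSpace ℝ (Fin (d - 1) ⊕ Unit ⊕ Fin (d - 1))

/-- The point `(z₀, z₁, z₂)`. -/
def point {d : ℕ} (z₀ : EuclideanSpace ℝ (Fin (d - 1))) (z₁ : ℝ)
    (z₂ : EuclideanSpace ℝ (Fin (d - 1))) : Space d :=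
  WithLp.toLp 2 (Sum.elim z₀ (Sum.elim (fun _ => z₁) z₂))

/-- `K₀ = {(z₀, z₁, 0) : |z₀|² + z₁² = 1}`. -/
def K₀ (d : ℕ) : Set (Space d) :=
  {x | ∃ (z₀ : EuclideanSpace ℝ (Fin (d - 1))) (z₁ : ℝ),
    ‖z₀‖ ^ 2 + z₁ ^ 2 = 1 ∧ x = point z₀ z₁ 0}

/-- `K₁ = {(0, z₁ + 1, z₂) : z₁² + |z₂|² = 1}`. -/
def K₁ (d : ℕ) : Set (Space d) :=
  {x | ∃ (z₁ : ℝ) (z₂ : EuclideanSpace ℝ (Fin (d - 1))),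
    z₁ ^ 2 + ‖z₂‖ ^ 2 = 1 ∧ x = point 0 (z₁ + 1) z₂}

/-- `K₂ = {(z₀, z₁, z) : |z₀|² + z₁² = 1}` for a fixed vector `z`. -/
def K₂ (d : ℕ) (z : EuclideanSpace ℝ (Fin (d - 1))) : Set (Space d) :=
  {x | ∃ (z₀ : EuclideanSpace ℝ (Fin (d - 1))) (z₁ : ℝ),
    ‖z₀‖ ^ 2 + z₁ ^ 2 = 1 ∧ x = point z₀ z₁ z}

end Spheres

end ConormalSpin

open ConormalSpin

universe u

/-!
A rigid motion carries `K₁` to `K₂`, but on the way it has to pass through `K₀`. Its lift to the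
unit conormal bundles need not meet the unit conormal bundle of `K₀`: `K₁` is moved along the
`z₁`-axis, in its own coordinate plane, so that it meets `K₀` only at points where the conormals of
`K₁` have no `z₂`-component and those of `K₀` have no `z₀`-component. Rotating the covectors over
`K₁` by a right angle in the `(z₀, z₂)`-plane and pushing them off makes their `z₀`-component
nonzero there, so the two unit conormal bundles stay disjoint. After the passage the rotation of
the covectors is caught up by a rotation of the sphere and the push is undone, so that the isotopy
ends with the cotangent lift of a rigid motion.

A rigid motion that can be joined to the identity is covered by an automorphism of the spin
structure of the ambient space, by homotopy lifting. Such an automorphism induces an isomorphism of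
the spin structures on the unit conormal bundles of `K₁` and `K₂`, and the isomorphisms over the
disjoint pieces of a link glue.
-/

namespace ConormalSpin

open Filter Topology

section DisjointUnion

variable {X : Type*} [TopologicalSpace X] {Q P : Set X} {q : X}

theorem eventually_mem_union_iff_left (hP : IsClosed P) (hd : Disjoint Q P) (hq : q ∈ Q) :
    ∀ᶠ y in 𝓝 q, y ∈ Q ∪ P ↔ y ∈ Q := by
  filter_upwards [hP.isOpen_compl.mem_nhds (disjoint_left.1 hd hq)] with y hy
  exact or_iff_left hy

theorem eventually_mem_union_iff_right (hQ : IsClosed Q) (hd : Disjoint Q P) (hq : q ∈ P) :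
    ∀ᶠ y in 𝓝 q, y ∈ Q ∪ P ↔ y ∈ P := by
  simpa only [union_comm] using eventually_mem_union_iff_left hQ hd.symm hq

end DisjointUnion

section TangentSpace

variable {V W : Type} [NormedAddCommGroup V] [NormedSpace ℝ V]
  [NormedAddCommGroup W] [NormedSpace ℝ W] {S : Set V} {T : Set W} {x v : V}

theorem tangentSpace_univ (x : V) : tangentSpace (univ : Set V) x = ⊤ := by
  rw [tangentSpace, tangentConeAt_univ, Submodule.span_univ]

theorem tangentSpace_mono {S' : Set V} (h : S ⊆ S') (x : V) :
    tangentSpace S x ≤ tangentSpace S' x :=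
  Submodule.span_mono (tangentConeAt_mono h)

theorem fderivWithin_unique_of_mem_tangentSpace {f : V → W} {f' f'' : V →L[ℝ] W}
    (h' : HasFDerivWithinAt f f' S x) (h'' : HasFDerivWithinAt f f'' S x)
    (hv : v ∈ tangentSpace S x) : f' v = f'' v :=
  LinearMap.eqOn_span (f := (f' : V →ₗ[ℝ] W)) (g := (f'' : V →ₗ[ℝ] W)) (h'.unique_on h'') hv

theorem fderivWithin_apply_of_mem_tangentSpace {f : V → W} {f' : V →L[ℝ] W}
    (h : HasFDerivWithinAt f f' S x) (hv : v ∈ tangentSpace S x) :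
    fderivWithin ℝ f S x v = f' v :=
  fderivWithin_unique_of_mem_tangentSpace h.differentiableWithinAt.hasFDerivWithinAt h hv

theorem apply_eq_zero_of_mem_tangentSpace {f : V → W} {f' : V →L[ℝ] W} {c : W}
    (h : HasFDerivWithinAt f f' S x) (hx : x ∈ S) (hc : ∀ y ∈ S, f y = c)
    (hv : v ∈ tangentSpace S x) : f' v = 0 :=
  fderivWithin_unique_of_mem_tangentSpace h
    ((hasFDerivWithinAt_const c x S).congr hc (hc x hx)) hv

theorem apply_mem_tangentSpace {f : V → W} {f' : V →L[ℝ] W} (h : HasFDerivWithinAt f f' S x)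
    (hf : ∀ᶠ y in 𝓝[S] x, f y ∈ T) (hv : v ∈ tangentSpace S x) :
    f' v ∈ tangentSpace T (f x) := by
  have hcone : tangentConeAt ℝ S x = tangentConeAt ℝ (S ∩ {y | f y ∈ T}) x :=
    tangentConeAt_congr (nhdsWithin_inter_of_mem' hf).symm
  have hspan : tangentSpace S x ≤ (tangentSpace T (f x)).comap (f' : V →ₗ[ℝ] W) := by
    refine Submodule.span_le.2 fun w hw => Submodule.subset_span ?_
    refine tangentConeAt_mono (image_subset_iff.2 inter_subset_right)
      ((h.mono inter_subset_left).mapsTo_tangent_cone (hcone ▸ hw))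
  exact hspan hv

theorem deriv_mem_tangentSpace {γ : ℝ → V} {t : ℝ} (h : HasDerivAt γ v t)
    (hγ : ∀ s, γ s ∈ S) : v ∈ tangentSpace S (γ t) := by
  simpa using apply_mem_tangentSpace h.hasFDerivAt.hasFDerivWithinAt
    (.of_forall hγ) (v := (1 : ℝ)) (by rw [tangentSpace_univ]; trivial)

theorem tangentSpace_eq_map (e : V ≃ₜ W) {L : V ≃L[ℝ] W}
    (he : HasFDerivAt e (L : V →L[ℝ] W) x) (h : ∀ᶠ y in 𝓝 x, e y ∈ T ↔ y ∈ S) :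
    tangentSpace T (e x) = (tangentSpace S x).map (L : V →ₗ[ℝ] W) := by
  apply le_antisymm
  · intro w hw
    have hsymm : HasFDerivAt e.symm (L.symm : W →L[ℝ] V) (e x) := by
      refine HasFDerivAt.of_local_left_inverse e.symm.continuous.continuousAt ?_
        (.of_forall e.apply_symm_apply)
      rwa [e.symm_apply_apply]
    have hmem : ∀ᶠ y in 𝓝[T] e x, e.symm y ∈ S := by
      have hx : Tendsto e.symm (𝓝 (e x)) (𝓝 x) := by
        simpa using e.symm.continuous.tendsto (e x)
      filter_upwards [nhdsWithin_le_nhds (hx.eventually h), self_mem_nhdsWithin] with y hy hyT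
      exact hy.1 (by rwa [e.apply_symm_apply])
    have hw' := apply_mem_tangentSpace hsymm.hasFDerivWithinAt hmem hw
    rw [e.symm_apply_apply] at hw'
    exact ⟨L.symm w, hw', L.apply_symm_apply w⟩
  · rintro _ ⟨v, hv, rfl⟩
    refine apply_mem_tangentSpace he.hasFDerivWithinAt ?_ hv
    filter_upwards [nhdsWithin_le_nhds h, self_mem_nhdsWithin] with y hy using hy.2

theorem tangentSpace_congr {S' : Set V} (h : ∀ᶠ y in 𝓝 x, y ∈ S' ↔ y ∈ S) :
    tangentSpace S' x = tangentSpace S x :=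
  (tangentSpace_eq_map (Homeomorph.refl V) (L := ContinuousLinearEquiv.refl ℝ V)
    (hasFDerivAt_id x) h).trans (Submodule.map_id _)

end TangentSpace

section Frames

variable {V W : Type} [NormedAddCommGroup V] [NormedSpace ℝ V]
  [NormedAddCommGroup W] [NormedSpace ℝ W] {S : Set V} {T : Set W} {k : ℕ}

theorem apply_mem_tangentSpace_of_mem_frameBundle {a : V × (Fin k → V)}
    (ha : a ∈ frameBundle S k) (i : Fin k) : a.2 i ∈ tangentSpace S a.1 :=
  ha.2.2 ▸ Submodule.subset_span (mem_range_self i)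

/-- The map of frames induced by a homeomorphism `e` whose differential is everywhere `L`. -/
def frameHomeomorph (e : V ≃ₜ W) (L : V ≃L[ℝ] W) (k : ℕ) :
    V × (Fin k → V) ≃ₜ W × (Fin k → W) :=
  e.prodCongr (Homeomorph.piCongrRight fun _ => L.toHomeomorph)

@[simp] theorem frameHomeomorph_apply (e : V ≃ₜ W) (L : V ≃L[ℝ] W) (a : V × (Fin k → V)) :
    frameHomeomorph e L k a = (e a.1, fun i => L (a.2 i)) := rfl

theorem frameHomeomorph_mem_frameBundle_iff (e : V ≃ₜ W) {L : V ≃L[ℝ] W} {a : V × (Fin k → V)}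
    (he : HasFDerivAt e (L : V →L[ℝ] W) a.1) (h : ∀ᶠ y in 𝓝 a.1, e y ∈ T ↔ y ∈ S) :
    frameHomeomorph e L k a ∈ frameBundle T k ↔ a ∈ frameBundle S k := by
  have hli : LinearIndependent ℝ (fun i => L (a.2 i)) ↔ LinearIndependent ℝ a.2 :=
    (L : V →ₗ[ℝ] W).linearIndependent_iff (LinearMap.ker_eq_bot.2 L.injective)
  have hspan : Submodule.span ℝ (range fun i => L (a.2 i)) =
      (Submodule.span ℝ (range a.2)).map (L : V →ₗ[ℝ] W) := by
    rw [Submodule.map_span, ← range_comp]; rfl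
  simp only [frameBundle, mem_ofPred_eq, frameHomeomorph_apply, hli, hspan,
    h.self_of_nhds, tangentSpace_eq_map e he h,
    (Submodule.map_injective_of_injective (f := (L : V →ₗ[ℝ] W)) L.injective).eq_iff]

end Frames

section RigidMotion

variable {V W : Type} [NormedAddCommGroup V] [InnerProductSpace ℝ V]
  [NormedAddCommGroup W] [InnerProductSpace ℝ W]

theorem hasFDerivAt_affineIsometryEquiv (ρ : V ≃ᵃⁱ[ℝ] W) (x : V) :
    HasFDerivAt ρ (ρ.linearIsometryEquiv.toContinuousLinearEquiv : V →L[ℝ] W) x := by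
  have hρ : ⇑ρ = fun y => ρ.linearIsometryEquiv y + ρ 0 := by
    ext y
    simpa using ρ.map_vadd 0 y
  rw [hρ]
  exact (ρ.linearIsometryEquiv.toContinuousLinearEquiv.hasFDerivAt (x := x)).add_const (ρ 0)

/-- The action of a rigid motion on cotangent bundles, which are identified with `V × V` and
`W × W` by the metrics. -/
noncomputable def cotangentLift (ρ : V ≃ᵃⁱ[ℝ] W) : V × V ≃ₜ W × W :=
  ρ.toHomeomorph.prodCongr ρ.linearIsometryEquiv.toHomeomorph

/-- The differential of `cotangentLift ρ`. -/
noncomputable def cotangentLiftDeriv (ρ : V ≃ᵃⁱ[ℝ] W) : (V × V) ≃L[ℝ] (W × W) :=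
  ρ.linearIsometryEquiv.toContinuousLinearEquiv.prodCongr
    ρ.linearIsometryEquiv.toContinuousLinearEquiv

@[simp] theorem cotangentLift_apply (ρ : V ≃ᵃⁱ[ℝ] W) (x : V × V) :
    cotangentLift ρ x = (ρ x.1, ρ.linearIsometryEquiv x.2) := rfl

@[simp] theorem cotangentLiftDeriv_apply (ρ : V ≃ᵃⁱ[ℝ] W) (x : V × V) :
    cotangentLiftDeriv ρ x = (ρ.linearIsometryEquiv x.1, ρ.linearIsometryEquiv x.2) := rfl

@[simp] theorem cotangentLift_refl :
    cotangentLift (AffineIsometryEquiv.refl ℝ V) = Homeomorph.refl (V × V) := rfl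

theorem hasFDerivAt_cotangentLift (ρ : V ≃ᵃⁱ[ℝ] W) (x : V × V) :
    HasFDerivAt (cotangentLift ρ) (cotangentLiftDeriv ρ : V × V →L[ℝ] W × W) x :=
  (hasFDerivAt_affineIsometryEquiv ρ x.1).prodMap x
    ρ.linearIsometryEquiv.toContinuousLinearEquiv.hasFDerivAt

variable {ρ : V ≃ᵃⁱ[ℝ] W} {K : Set V} {K' : Set W} {x : V × V}

theorem tangentSpace_eq_map_of_rigid {q : V} (h : ∀ᶠ y in 𝓝 q, ρ y ∈ K' ↔ y ∈ K) :
    tangentSpace K' (ρ q) =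
      (tangentSpace K q).map (ρ.linearIsometryEquiv.toLinearEquiv : V →ₗ[ℝ] W) :=
  tangentSpace_eq_map ρ.toHomeomorph (hasFDerivAt_affineIsometryEquiv ρ q) h

theorem cotangentLift_mem_conormal_iff (h : ∀ᶠ y in 𝓝 x.1, ρ y ∈ K' ↔ y ∈ K) :
    cotangentLift ρ x ∈ conormal K' ↔ x ∈ conormal K := by
  simp only [conormal, mem_ofPred_eq, cotangentLift_apply, h.self_of_nhds,
    tangentSpace_eq_map_of_rigid h, Submodule.mem_map, forall_exists_index, and_imp,
    forall_apply_eq_imp_iff₂]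
  exact and_congr_right' (forall₂_congr fun v _ => by
    rw [← ρ.linearIsometryEquiv.inner_map_map]; rfl)

theorem cotangentLift_mem_unitConormal_iff (h : ∀ᶠ y in 𝓝 x.1, ρ y ∈ K' ↔ y ∈ K) :
    cotangentLift ρ x ∈ unitConormal K' ↔ x ∈ unitConormal K := by
  rw [unitConormal, unitConormal, mem_inter_iff, cotangentLift_mem_conormal_iff h]
  simp [unitCotangent]

theorem eventually_cotangentLift_mem_conormal_iff (h : ∀ᶠ y in 𝓝 x.1, ρ y ∈ K' ↔ y ∈ K) :
    ∀ᶠ y in 𝓝 x, cotangentLift ρ y ∈ conormal K' ↔ y ∈ conormal K :=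
  (continuous_fst.continuousAt.eventually h.eventually_nhds).mono
    fun _ => cotangentLift_mem_conormal_iff

theorem eventually_cotangentLift_mem_unitConormal_iff (h : ∀ᶠ y in 𝓝 x.1, ρ y ∈ K' ↔ y ∈ K) :
    ∀ᶠ y in 𝓝 x, cotangentLift ρ y ∈ unitConormal K' ↔ y ∈ unitConormal K :=
  (continuous_fst.continuousAt.eventually h.eventually_nhds).mono
    fun _ => cotangentLift_mem_unitConormal_iff

theorem conormalIso_cotangentLift [FiniteDimensional ℝ V] [FiniteDimensional ℝ W]
    (h : ∀ᶠ y in 𝓝 x.1, ρ y ∈ K' ↔ y ∈ K) (w : V × V) :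
    conormalIso K' (cotangentLift ρ x) (cotangentLiftDeriv ρ w) =
      ρ.linearIsometryEquiv (conormalIso K x w) := by
  have hproj := Submodule.starProjection_map_apply ρ.linearIsometryEquiv (tangentSpace K x.1)
    (ρ.linearIsometryEquiv w.2)
  rw [LinearIsometryEquiv.symm_apply_apply] at hproj
  simp only [conormalIso, LinearMap.add_apply, LinearMap.fst_apply, LinearMap.comp_apply,
    LinearMap.snd_apply, cotangentLiftDeriv_apply, map_add, cotangentLift_apply,
    Submodule.starProjection_orthogonal_val, ContinuousLinearMap.coe_coe, map_sub,
    tangentSpace_eq_map_of_rigid h, ← hproj]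

theorem cotangentLift_image_unitConormal (ρ : V ≃ᵃⁱ[ℝ] W) (K : Set V) :
    cotangentLift ρ '' unitConormal K = unitConormal (ρ '' K) := by
  ext y
  obtain ⟨x, rfl⟩ := (cotangentLift ρ).surjective y
  rw [(cotangentLift ρ).injective.mem_set_image, cotangentLift_mem_unitConormal_iff
    (.of_forall fun _ => ρ.injective.mem_set_image)]

theorem eventually_mem_conormal_iff {K' : Set V} (h : ∀ᶠ y in 𝓝 x.1, y ∈ K' ↔ y ∈ K) :
    ∀ᶠ y in 𝓝 x, y ∈ conormal K' ↔ y ∈ conormal K := by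
  simpa using eventually_cotangentLift_mem_conormal_iff (ρ := .refl ℝ V) h

theorem eventually_mem_unitConormal_iff {K' : Set V} (h : ∀ᶠ y in 𝓝 x.1, y ∈ K' ↔ y ∈ K) :
    ∀ᶠ y in 𝓝 x, y ∈ unitConormal K' ↔ y ∈ unitConormal K := by
  simpa using eventually_cotangentLift_mem_unitConormal_iff (ρ := .refl ℝ V) h

theorem conormalIso_congr [FiniteDimensional ℝ V] {K' : Set V}
    (h : ∀ᶠ y in 𝓝 x.1, y ∈ K' ↔ y ∈ K) : conormalIso K' x = conormalIso K x :=
  LinearMap.ext fun w => conormalIso_cotangentLift (ρ := .refl ℝ V) h w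

theorem unitConormal_union {Q P : Set V} (hQ : IsClosed Q) (hP : IsClosed P)
    (hd : Disjoint Q P) : unitConormal (Q ∪ P) = unitConormal Q ∪ unitConormal P := by
  have hleft (x : V × V) (hx : x.1 ∈ Q) : x ∈ unitConormal (Q ∪ P) ↔ x ∈ unitConormal Q :=
    (eventually_mem_unitConormal_iff (eventually_mem_union_iff_left hP hd hx)).self_of_nhds
  have hright (x : V × V) (hx : x.1 ∈ P) : x ∈ unitConormal (Q ∪ P) ↔ x ∈ unitConormal P :=
    (eventually_mem_unitConormal_iff (eventually_mem_union_iff_right hQ hd hx)).self_of_nhds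
  ext x
  refine ⟨fun hx => hx.1.1.imp (fun h => (hleft x h).1 hx) fun h => (hright x h).1 hx, ?_⟩
  rintro (hx | hx)
  · exact (hleft x hx.1.1).2 hx
  · exact (hright x hx.1.1).2 hx

end RigidMotion

section RoundSphere

variable {V : Type} [NormedAddCommGroup V] [InnerProductSpace ℝ V]

/-- The unit sphere around `c` in the affine subspace `c + E`. -/
def roundSphere (c : V) (E : Submodule ℝ V) : Set V := {q | q - c ∈ E ∧ ‖q - c‖ = 1}

variable {c q v : V} {E : Submodule ℝ V} {x y : V × V}

theorem mem_tangentSpace_roundSphere_of_norm_eq_one (hq : q ∈ roundSphere c E) (hv : v ∈ E)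
    (hqv : ⟪q - c, v⟫_ℝ = 0) (hv1 : ‖v‖ = 1) : v ∈ tangentSpace (roundSphere c E) q := by
  have hderiv : HasDerivAt (fun t : ℝ => c + (Real.cos t • (q - c) + Real.sin t • v)) v 0 := by
    simpa using (((Real.hasDerivAt_cos 0).smul_const (q - c)).add
      ((Real.hasDerivAt_sin 0).smul_const v)).const_add c
  have hmem (t : ℝ) : c + (Real.cos t • (q - c) + Real.sin t • v) ∈ roundSphere c E := by
    have hnorm : ‖Real.cos t • (q - c) + Real.sin t • v‖ ^ 2 = 1 ^ 2 := by
      simp [norm_add_sq_real, norm_smul, inner_smul_left, inner_smul_right, hqv, hq.2, hv1]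
    refine ⟨?_, ?_⟩ <;> rw [add_sub_cancel_left]
    · exact E.add_mem (E.smul_mem _ hq.1) (E.smul_mem _ hv)
    · exact (sq_eq_sq₀ (norm_nonneg _) zero_le_one).1 hnorm
  simpa using deriv_mem_tangentSpace hderiv hmem

theorem fst_mem_tangentSpace_of_mem_tangentSpace_conormal {K : Set V}
    (hy : y ∈ tangentSpace (conormal K) x) : y.1 ∈ tangentSpace K x.1 :=
  apply_mem_tangentSpace (hasFDerivAt_fst (𝕜 := ℝ) (p := x)).hasFDerivWithinAt
    (eventually_mem_nhdsWithin.mono fun _ h => h.1) hy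

variable [FiniteDimensional ℝ V]

theorem isClosed_roundSphere (c : V) (E : Submodule ℝ V) : IsClosed (roundSphere c E) :=
  (E.closed_of_finiteDimensional.preimage (continuous_id.sub continuous_const)).inter
    (isClosed_eq (continuous_id.sub continuous_const).norm continuous_const)

theorem mem_and_inner_eq_zero_of_mem_tangentSpace_roundSphere (hq : q ∈ roundSphere c E)
    (hv : v ∈ tangentSpace (roundSphere c E) q) : v ∈ E ∧ ⟪q - c, v⟫_ℝ = 0 := by
  have hsub : HasFDerivAt (fun y => y - c) (ContinuousLinearMap.id ℝ V) q :=
    (hasFDerivAt_id q).sub_const c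
  have hmem_iff (w : V) : Eᗮ.starProjection w = 0 ↔ w ∈ E := by
    rw [Submodule.starProjection_apply_eq_zero_iff, Submodule.orthogonal_orthogonal]
  constructor
  · exact (hmem_iff v).1 <| apply_eq_zero_of_mem_tangentSpace (c := (0 : V))
      (Eᗮ.starProjection.hasFDerivAt.comp q hsub).hasFDerivWithinAt hq
      (fun y hy => (hmem_iff _).2 hy.1) hv
  · have h := apply_eq_zero_of_mem_tangentSpace hsub.norm_sq.hasFDerivWithinAt hq (c := 1)
      (fun y hy => by rw [hy.2, one_pow]) hv
    simpa [← inner_sub_left] using h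

theorem mem_tangentSpace_roundSphere_iff (hq : q ∈ roundSphere c E) :
    v ∈ tangentSpace (roundSphere c E) q ↔ v ∈ E ∧ ⟪q - c, v⟫_ℝ = 0 := by
  refine ⟨mem_and_inner_eq_zero_of_mem_tangentSpace_roundSphere hq, fun ⟨hv, hqv⟩ => ?_⟩
  rcases eq_or_ne v 0 with rfl | h0
  · exact Submodule.zero_mem _
  · rw [← smul_inv_smul₀ (norm_ne_zero_iff.2 h0) v]
    exact Submodule.smul_mem _ _ (mem_tangentSpace_roundSphere_of_norm_eq_one hq
      (E.smul_mem _ hv) (by rw [inner_smul_right, hqv, mul_zero]) (norm_smul_inv_norm h0))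

theorem starProjection_tangentSpace_roundSphere (hq : q ∈ roundSphere c E) (w : V) :
    (tangentSpace (roundSphere c E) q).starProjection w =
      E.starProjection w - ⟪q - c, w⟫_ℝ • (q - c) := by
  have hinner (v : V) (hv : v ∈ E) : ⟪v, E.starProjection w⟫_ℝ = ⟪v, w⟫_ℝ := by
    rw [← Submodule.inner_starProjection_left_eq_right, Submodule.starProjection_eq_self_iff.2 hv]
  apply Submodule.eq_starProjection_of_mem_of_inner_eq_zero
  · refine (mem_tangentSpace_roundSphere_iff hq).2
      ⟨E.sub_mem (Submodule.starProjection_apply_mem _ _) (E.smul_mem _ hq.1), ?_⟩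
    rw [inner_sub_right, inner_smul_right, real_inner_self_eq_norm_sq, hq.2, hinner _ hq.1,
      one_pow, mul_one, sub_self]
  · intro v hv
    obtain ⟨hvE, hqv⟩ := (mem_tangentSpace_roundSphere_iff hq).1 hv
    rw [real_inner_comm, inner_sub_right, inner_sub_right, inner_smul_right, hinner v hvE,
      real_inner_comm (q - c), hqv, mul_zero, sub_zero, sub_self]

theorem mem_conormal_roundSphere_iff :
    x ∈ conormal (roundSphere c E) ↔ x.1 ∈ roundSphere c E ∧
      E.starProjection x.2 = ⟪x.1 - c, x.2⟫_ℝ • (x.1 - c) := by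
  refine and_congr_right fun hq => ?_
  rw [← Submodule.mem_orthogonal', ← Submodule.starProjection_apply_eq_zero_iff,
    starProjection_tangentSpace_roundSphere hq, sub_eq_zero]

theorem conormalIso_roundSphere (hq : x.1 ∈ roundSphere c E) (y : V × V) :
    conormalIso (roundSphere c E) x y =
      y.1 + (y.2 - (E.starProjection y.2 - ⟪x.1 - c, y.2⟫_ℝ • (x.1 - c))) := by
  simp only [conormalIso, LinearMap.add_apply, LinearMap.fst_apply, LinearMap.comp_apply,
    LinearMap.snd_apply, Submodule.starProjection_orthogonal_val, ContinuousLinearMap.coe_coe,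
    starProjection_tangentSpace_roundSphere hq]

theorem starProjection_snd_of_mem_tangentSpace_conormal_roundSphere
    (hx : x ∈ conormal (roundSphere c E))
    (hy : y ∈ tangentSpace (conormal (roundSphere c E)) x) :
    E.starProjection y.2 =
      ⟪x.1 - c, x.2⟫_ℝ • y.1 + (⟪x.1 - c, y.2⟫_ℝ + ⟪y.1, x.2⟫_ℝ) • (x.1 - c) := by
  have hfst : HasFDerivAt (fun z : V × V => z.1 - c) (ContinuousLinearMap.fst ℝ V V) x :=
    hasFDerivAt_fst.sub_const c
  have hproj : HasFDerivAt (fun z : V × V => E.starProjection z.2)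
      (E.starProjection ∘L ContinuousLinearMap.snd ℝ V V) x :=
    E.starProjection.hasFDerivAt.comp x hasFDerivAt_snd
  have hsub := hproj.sub ((hfst.inner ℝ (hasFDerivAt_snd (𝕜 := ℝ))).smul hfst)
  have h := apply_eq_zero_of_mem_tangentSpace hsub.hasFDerivWithinAt hx (c := 0)
    (fun z hz => sub_eq_zero.2 (mem_conormal_roundSphere_iff.1 hz).2) hy
  simpa [sub_eq_zero, fderivInnerCLM_apply] using h

theorem eq_zero_of_conormalIso_roundSphere_eq_zero (hx : x ∈ conormal (roundSphere c E))
    (hy : y ∈ tangentSpace (conormal (roundSphere c E)) x)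
    (h0 : conormalIso (roundSphere c E) x y = 0) : y = 0 := by
  obtain ⟨hyE, hqy⟩ := (mem_tangentSpace_roundSphere_iff hx.1).1
    (fst_mem_tangentSpace_of_mem_tangentSpace_conormal hy)
  have hproj := starProjection_snd_of_mem_tangentSpace_conormal_roundSphere hx hy
  rw [conormalIso_roundSphere hx.1] at h0
  have htangent : y.1 + ⟪x.1 - c, y.2⟫_ℝ • (x.1 - c) = 0 := by
    have h := congrArg E.starProjection h0
    simp only [map_add, map_sub, map_smul, map_zero, Submodule.starProjection_eq_self_iff.2 hyE,
      Submodule.starProjection_eq_self_iff.2 hx.1.1, Submodule.starProjection_eq_self_iff.2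
      (Submodule.starProjection_apply_mem E y.2)] at h
    rwa [sub_sub_cancel] at h
  have hradial : ⟪x.1 - c, y.2⟫_ℝ = 0 := by
    have h := congrArg (inner ℝ (x.1 - c)) htangent
    simpa [inner_add_right, inner_smul_right, hqy, hx.1.2] using h
  have hfst : y.1 = 0 := by simpa [hradial] using htangent
  rw [hradial, hfst, inner_zero_left, smul_zero, add_zero, zero_add, zero_smul] at hproj
  have hsnd : y.2 = 0 := by simpa [hradial, hfst, hproj] using h0
  exact Prod.ext hfst hsnd

end RoundSphere

section SphereUnion

variable {V : Type} [NormedAddCommGroup V] [InnerProductSpace ℝ V]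

/-- Every point of `K` has a neighbourhood in which `K` is a round unit sphere of dimension
`d - 1`. -/
def IsSphereUnion (d : ℕ) (K : Set V) : Prop :=
  ∀ q ∈ K, ∃ (c : V) (E : Submodule ℝ V), Module.finrank ℝ E = d ∧ q ∈ roundSphere c E ∧
    ∀ᶠ q' in 𝓝 q, q' ∈ K ↔ q' ∈ roundSphere c E

variable [FiniteDimensional ℝ V] {d : ℕ} {K : Set V} {x y : V × V}

theorem isSphereUnion_union {c c' : V} {E E' : Submodule ℝ V}
    (hE : Module.finrank ℝ E = d) (hE' : Module.finrank ℝ E' = d)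
    (hdisj : Disjoint (roundSphere c E) (roundSphere c' E')) :
    IsSphereUnion d (roundSphere c E ∪ roundSphere c' E') := by
  rintro q (hq | hq)
  · exact ⟨c, E, hE, hq, eventually_mem_union_iff_left (isClosed_roundSphere c' E') hdisj hq⟩
  · exact ⟨c', E', hE', hq, eventually_mem_union_iff_right (isClosed_roundSphere c E) hdisj hq⟩

theorem IsSphereUnion.eq_zero_of_conormalIso_eq_zero (hK : IsSphereUnion d K)
    (hx : x ∈ conormal K) (hy : y ∈ tangentSpace (conormal K) x)
    (h0 : conormalIso K x y = 0) : y = 0 := by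
  obtain ⟨c, E, -, -, h⟩ := hK x.1 hx.1
  have hconormal := eventually_mem_conormal_iff h
  rw [tangentSpace_congr hconormal] at hy
  rw [conormalIso_congr h] at h0
  exact eq_zero_of_conormalIso_roundSphere_eq_zero (hconormal.self_of_nhds.1 hx) hy h0

theorem IsSphereUnion.continuousOn_conormalIso (hK : IsSphereUnion d K) :
    ContinuousOn (fun a : (V × V) × (V × V) => conormalIso K a.1 a.2) {a | a.1.1 ∈ K} := by
  intro a ha
  obtain ⟨c, E, -, -, h⟩ := hK a.1.1 ha
  have hnear : ∀ᶠ b : (V × V) × (V × V) in 𝓝 a, ∀ᶠ q in 𝓝 b.1.1, q ∈ K ↔ q ∈ roundSphere c E :=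
    (by fun_prop : Continuous fun b : (V × V) × (V × V) => b.1.1).continuousAt.eventually
      h.eventually_nhds
  have hformula {b : (V × V) × (V × V)} (hb : ∀ᶠ q in 𝓝 b.1.1, q ∈ K ↔ q ∈ roundSphere c E)
      (hbK : b.1.1 ∈ K) : conormalIso K b.1 b.2 = b.2.1 + (b.2.2 -
        (E.starProjection b.2.2 - ⟪b.1.1 - c, b.2.2⟫_ℝ • (b.1.1 - c))) := by
    rw [conormalIso_congr hb, conormalIso_roundSphere (hb.self_of_nhds.1 hbK)]
  have hcont : Continuous fun b : (V × V) × (V × V) => b.2.1 + (b.2.2 -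
      (E.starProjection b.2.2 - ⟪b.1.1 - c, b.2.2⟫_ℝ • (b.1.1 - c))) := by fun_prop
  refine hcont.continuousWithinAt.congr_of_eventuallyEq ?_ (hformula h ha)
  filter_upwards [nhdsWithin_le_nhds hnear, self_mem_nhdsWithin] with b hb hbK
  exact hformula hb hbK

theorem IsSphereUnion.finrank_tangentSpace_conormal_le (hK : IsSphereUnion d K)
    (hx : x ∈ conormal K) :
    Module.finrank ℝ (tangentSpace (conormal K) x) ≤ Module.finrank ℝ V := by
  refine LinearMap.finrank_le_finrank_of_injective
    (f := (conormalIso K x).domRestrict (tangentSpace (conormal K) x)) ?_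
  rw [← LinearMap.ker_eq_bot, LinearMap.ker_eq_bot']
  exact fun y hy => Subtype.ext (hK.eq_zero_of_conormalIso_eq_zero hx y.2 hy)

end SphereUnion

section Submanifold

variable {V W X : Type} [NormedAddCommGroup V] [NormedSpace ℝ V]
  [NormedAddCommGroup W] [NormedSpace ℝ W] [NormedAddCommGroup X] [NormedSpace ℝ X]

theorem IsSmoothEmbeddingOn.mono {f : V → W} {S T : Set V} (hf : IsSmoothEmbeddingOn f T)
    (h : S ⊆ T) : IsSmoothEmbeddingOn f S := by
  obtain ⟨hsmooth, g, hg, hgf⟩ := hf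
  exact ⟨hsmooth.mono h, g, hg.mono (image_mono h), hgf.mono h⟩

theorem IsSmoothEmbeddingOn.comp {g : W → X} {f : V → W} {S : Set V}
    (hg : IsSmoothEmbeddingOn g (f '' S)) (hf : IsSmoothEmbeddingOn f S) :
    IsSmoothEmbeddingOn (g ∘ f) S := by
  obtain ⟨hfs, f', hf', hff'⟩ := hf
  obtain ⟨hgs, g', hg', hgg'⟩ := hg
  have hmaps : MapsTo g' (g ∘ f '' S) (f '' S) := by
    rw [image_comp]
    exact mapsTo_iff_image_subset.2 hgg'.image_image.subset
  exact ⟨hgs.comp hfs (mapsTo_image _ _), f' ∘ g', hf'.comp (image_comp g f S ▸ hg') hmaps,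
    hff'.comp hgg' (mapsTo_image _ _)⟩

theorem IsSmoothSubmanifold.image {k : ℕ} {S : Set V} (hS : IsSmoothSubmanifold k S) {f : V → W}
    (hf : IsSmoothEmbeddingOn f S) : IsSmoothSubmanifold k (f '' S) := by
  rintro _ ⟨x, hx, rfl⟩
  obtain ⟨U, hU, hxU, O, hO, φ, hφ, hφO⟩ := hS x hx
  obtain ⟨g, hg, hgf⟩ := hf.2
  obtain ⟨U', hU', hUU'⟩ := continuousOn_iff'.1 hg.continuousOn U hU
  have hmem (y : V) (hy : y ∈ S) : f y ∈ U' ↔ y ∈ U := by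
    simpa only [mem_inter_iff, mem_preimage, mem_image_of_mem f hy, and_true, hgf hy]
      using (Set.ext_iff.1 hUU' (f y)).symm
  refine ⟨U', hU', (hmem x hx).2 hxU, O, hO, f ∘ φ,
    (hf.mono (hφO ▸ inter_subset_left)).comp hφ, ?_⟩
  rw [image_comp, hφO]
  apply Subset.antisymm
  · rintro _ ⟨y, hy, rfl⟩
    exact ⟨⟨y, hy.1, rfl⟩, (hmem y hy.1).2 hy.2⟩
  · rintro _ ⟨⟨y, hy, rfl⟩, hyU⟩
    exact ⟨y, ⟨hy, (hmem y hy).1 hyU⟩, rfl⟩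

theorem IsSmoothSubmanifold.prod {k l : ℕ} {S : Set V} {T : Set W}
    (hS : IsSmoothSubmanifold k S) (hT : IsSmoothSubmanifold l T) :
    IsSmoothSubmanifold (k + l) (S ×ˢ T) := by
  rintro ⟨x, y⟩ ⟨hx, hy⟩
  obtain ⟨U, hU, hxU, O, hO, φ, ⟨hφ, g, hg, hgφ⟩, hφO⟩ := hS x hx
  obtain ⟨U', hU', hxU', O', hO', φ', ⟨hφ', g', hg', hgφ'⟩, hφO'⟩ := hT y hy
  let e : EuclideanSpace ℝ (Fin (k + l)) ≃L[ℝ]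
      EuclideanSpace ℝ (Fin k) × EuclideanSpace ℝ (Fin l) :=
    ContinuousLinearEquiv.ofFinrankEq (by simp)
  have himage : Prod.map φ φ' ∘ e '' (e ⁻¹' (O ×ˢ O')) = (φ '' O) ×ˢ (φ' '' O') := by
    rw [image_comp, image_preimage_eq _ e.surjective, prodMap_image_prod]
  refine ⟨U ×ˢ U', hU.prod hU', ⟨hxU, hxU'⟩, e ⁻¹' (O ×ˢ O'),
    (hO.prod hO').preimage e.continuous, Prod.map φ φ' ∘ e,
    ⟨(hφ.prodMap hφ').comp e.contDiff.contDiffOn fun _ h => h, e.symm ∘ Prod.map g g', ?_, ?_⟩, ?_⟩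
  · exact himage ▸ e.symm.contDiff.comp_contDiffOn (hg.prodMap hg')
  · intro v hv
    simp only [Function.comp_apply, Prod.map, hgφ hv.1, hgφ' hv.2, Prod.mk.eta,
      e.symm_apply_apply]
  · rw [himage, hφO, hφO', prod_inter_prod]

theorem isSmoothSubmanifold_of_eventually {k : ℕ} {S : Set V}
    (h : ∀ x ∈ S, ∃ T : Set V, IsSmoothSubmanifold k T ∧ ∀ᶠ y in 𝓝 x, y ∈ S ↔ y ∈ T) :
    IsSmoothSubmanifold k S := by
  intro x hx
  obtain ⟨T, hT, hST⟩ := h x hx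
  obtain ⟨U, hU, hxU, O, hO, φ, hφ, hφO⟩ := hT x (hST.self_of_nhds.1 hx)
  obtain ⟨N, hN, hNo, hxN⟩ := eventually_nhds_iff.1 hST
  refine ⟨U ∩ N, hU.inter hNo, ⟨hxU, hxN⟩, O ∩ φ ⁻¹' N,
    hφ.1.continuousOn.isOpen_inter_preimage hO hNo, φ, hφ.mono inter_subset_left, ?_⟩
  rw [image_inter_preimage, hφO, inter_assoc, ← inter_assoc, ← inter_assoc]
  ext y
  simp only [mem_inter_iff]
  exact ⟨fun hy => ⟨⟨(hN y hy.2).2 hy.1.1, hy.1.2⟩, hy.2⟩,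
    fun hy => ⟨⟨(hN y hy.2).1 hy.1.1, hy.1.2⟩, hy.2⟩⟩

end Submanifold

section Spheres

theorem isSmoothSubmanifold_sphere {E : Type} [NormedAddCommGroup E] [InnerProductSpace ℝ E]
    {k : ℕ} [Fact (Module.finrank ℝ E = k + 1)] :
    IsSmoothSubmanifold k (Metric.sphere (0 : E) 1) := by
  intro x hx
  have hx1 : ‖x‖ = 1 := mem_sphere_zero_iff_norm.1 hx
  have hpole : ‖-x‖ = 1 := by rwa [norm_neg]
  have hx0 : -x ≠ 0 := norm_pos_iff.1 (hpole ▸ one_pos)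
  have : FiniteDimensional ℝ E := .of_fact_finrank_eq_succ k
  let e : EuclideanSpace ℝ (Fin k) ≃L[ℝ] (ℝ ∙ (-x))ᗮ :=
    ContinuousLinearEquiv.ofFinrankEq (by
      rw [finrank_euclideanSpace_fin, Submodule.finrank_orthogonal_span_singleton (n := k) hx0])
  have himage : (fun w => stereoInvFunAux (-x) (e w)) '' univ =
      Metric.sphere (0 : E) 1 ∩ {-x}ᶜ := by
    apply Subset.antisymm
    · rintro _ ⟨w, -, rfl⟩
      exact ⟨stereoInvFunAux_mem hpole (e w).2,
        fun h => stereoInvFun_ne_north_pole hpole (e w) (Subtype.ext h)⟩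
    · rintro y ⟨hy, hyx⟩
      refine ⟨e.symm (stereoToFun (-x) y), trivial, ?_⟩
      simp only [e.apply_symm_apply]
      exact congrArg Subtype.val (stereo_left_inv hpole (x := ⟨y, hy⟩) hyx)
  refine ⟨{-x}ᶜ, isOpen_compl_singleton, fun h => ?_, univ, isOpen_univ,
    fun w => stereoInvFunAux (-x) (e w), ⟨?_, fun y => e.symm (stereoToFun (-x) y), ?_, ?_⟩,
    himage⟩
  · exact ne_neg_of_mem_unit_sphere ℝ ⟨x, hx⟩ (Subtype.ext h)
  · exact (contDiff_stereoInvFunAux.comp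
      ((Submodule.subtypeL _).contDiff.comp e.contDiff)).contDiffOn
  · rw [himage]
    refine e.symm.contDiff.comp_contDiffOn (contDiffOn_stereoToFun.mono fun y hy => ?_)
    exact ((inner_lt_one_iff_real_of_norm_eq_one hpole
      (mem_sphere_zero_iff_norm.1 hy.1)).2 (Ne.symm hy.2)).ne
  · intro w _
    exact (congrArg e.symm (stereo_right_inv hpole (e w))).trans (e.symm_apply_apply w)

variable {V : Type} [NormedAddCommGroup V] [InnerProductSpace ℝ V] {c : V} {E : Submodule ℝ V}

/-- On the product of the unit spheres of `E` and `ℝ ⊕ Eᗮ`, this parametrizes the unit conormal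
bundle of `roundSphere c E`: at `c + v` the fibre of the conormal bundle is `ℝv ⊕ Eᗮ`. -/
def sphereConormalMap (c : V) (E : Submodule ℝ V) (y : E × WithLp 2 (ℝ × Eᗮ)) : V × V :=
  (c + y.1, y.2.fst • (y.1 : V) + y.2.snd)

theorem norm_sq_smul_add_of_mem_orthogonal {v m : V} (a : ℝ) (hv : v ∈ E) (hm : m ∈ Eᗮ)
    (hv1 : ‖v‖ = 1) : ‖a • v + m‖ ^ 2 = a ^ 2 + ‖m‖ ^ 2 := by
  rw [norm_add_sq_real, inner_smul_left, Submodule.inner_right_of_mem_orthogonal hv hm, norm_smul,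
    hv1, mul_zero, mul_zero, add_zero, mul_one, Real.norm_eq_abs, sq_abs]

theorem contDiff_sphereConormalMap : ContDiff ℝ ∞ (sphereConormalMap c E) := by
  have hlp : ContDiff ℝ ∞ fun y : E × WithLp 2 (ℝ × Eᗮ) => WithLp.ofLp y.2 :=
    (WithLp.prodContinuousLinearEquiv 2 ℝ ℝ Eᗮ).contDiff.comp contDiff_snd
  have hfst : ContDiff ℝ ∞ fun y : E × WithLp 2 (ℝ × Eᗮ) => (y.1 : V) :=
    E.subtypeL.contDiff.comp contDiff_fst
  exact (contDiff_const.add hfst).prodMk (((contDiff_fst.comp hlp).smul hfst).add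
    (Eᗮ.subtypeL.contDiff.comp (contDiff_snd.comp hlp)))

variable [FiniteDimensional ℝ V]

/-- The inverse of `sphereConormalMap c E`. -/
noncomputable def sphereConormalInv (c : V) (E : Submodule ℝ V) (x : V × V) :
    E × WithLp 2 (ℝ × Eᗮ) :=
  (E.orthogonalProjectionOnto (x.1 - c),
    WithLp.toLp 2 (⟪x.1 - c, x.2⟫_ℝ, Eᗮ.orthogonalProjectionOnto x.2))

theorem contDiff_sphereConormalInv : ContDiff ℝ ∞ (sphereConormalInv c E) := by
  have hsub : ContDiff ℝ ∞ fun x : V × V => x.1 - c := contDiff_fst.sub contDiff_const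
  exact (E.orthogonalProjectionOnto.contDiff.comp hsub).prodMk
    ((WithLp.prodContinuousLinearEquiv 2 ℝ ℝ Eᗮ).symm.contDiff.comp
      ((hsub.inner ℝ contDiff_snd).prodMk (Eᗮ.orthogonalProjectionOnto.contDiff.comp contDiff_snd)))

theorem sphereConormalInv_sphereConormalMap {y : E × WithLp 2 (ℝ × Eᗮ)} (hy : ‖y.1‖ = 1) :
    sphereConormalInv c E (sphereConormalMap c E y) = y := by
  obtain ⟨v, m⟩ := y
  have hv1 : ‖(v : V)‖ = 1 := hy
  have hinner : ⟪(v : V), (m.snd : V)⟫_ℝ = 0 :=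
    Submodule.inner_right_of_mem_orthogonal v.2 m.snd.2
  have hv : Eᗮ.orthogonalProjectionOnto (v : V) = 0 :=
    Submodule.orthogonalProjectionOnto_eq_zero_iff.2 (E.le_orthogonal_orthogonal v.2)
  simp only [sphereConormalInv, sphereConormalMap, add_sub_cancel_left, inner_add_right,
    inner_smul_right, real_inner_self_eq_norm_sq, hv1, hinner, map_add, map_smul, hv,
    Submodule.orthogonalProjectionOnto_mem_subspace_eq_self, one_pow, mul_one, add_zero,
    smul_zero, zero_add]
  rfl

theorem sphereConormalMap_image :
    sphereConormalMap c E '' (Metric.sphere 0 1 ×ˢ Metric.sphere 0 1) =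
      unitConormal (roundSphere c E) := by
  apply Subset.antisymm
  · rintro _ ⟨⟨v, m⟩, ⟨hv, hm⟩, rfl⟩
    rw [mem_sphere_zero_iff_norm] at hv hm
    have hv1 : ‖(v : V)‖ = 1 := hv
    refine ⟨mem_conormal_roundSphere_iff.2 ⟨?_, ?_⟩, ?_⟩
    · simp [sphereConormalMap, roundSphere, hv1]
    · have hmE : E.starProjection (m.snd : V) = 0 :=
        (Submodule.starProjection_apply_eq_zero_iff E).2 m.snd.2
      simp [sphereConormalMap, hmE, Submodule.starProjection_eq_self_iff.2 v.2, inner_add_right,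
        inner_smul_right, hv1, Submodule.inner_right_of_mem_orthogonal v.2 m.snd.2]
    · have h : ‖m.fst • (v : V) + m.snd‖ ^ 2 = 1 ^ 2 := by
        rw [norm_sq_smul_add_of_mem_orthogonal _ v.2 m.snd.2 hv1, ← hm,
          WithLp.prod_norm_sq_eq_of_L2, Real.norm_eq_abs, sq_abs, Submodule.coe_norm]
      exact (sq_eq_sq₀ (norm_nonneg _) zero_le_one).1 h
  · rintro ⟨q, p⟩ ⟨hx, hp1⟩
    obtain ⟨⟨hq, hq1⟩, hp⟩ := mem_conormal_roundSphere_iff.1 hx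
    have hdecomp : ⟪q - c, p⟫_ℝ • (q - c) + Eᗮ.starProjection p = p := by
      rw [← hp, Submodule.starProjection_add_starProjection_orthogonal]
    have hproj : E.orthogonalProjectionOnto (q - c) = ⟨q - c, hq⟩ :=
      Submodule.orthogonalProjectionOnto_mem_subspace_eq_self (⟨q - c, hq⟩ : E)
    refine ⟨sphereConormalInv c E (q, p), ⟨?_, ?_⟩, ?_⟩
    · rw [mem_sphere_zero_iff_norm, sphereConormalInv, hproj]
      exact hq1
    · have h : ‖(sphereConormalInv c E (q, p)).2‖ ^ 2 = 1 ^ 2 := by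
        rw [WithLp.prod_norm_sq_eq_of_L2, Real.norm_eq_abs, sq_abs, Submodule.coe_norm,
          ← show ‖p‖ = 1 from hp1]
        conv_rhs => rw [← hdecomp]
        exact (norm_sq_smul_add_of_mem_orthogonal _ hq
          (Submodule.starProjection_apply_mem _ _) hq1).symm
      exact mem_sphere_zero_iff_norm.2 ((sq_eq_sq₀ (norm_nonneg _) zero_le_one).1 h)
    · simpa [sphereConormalMap, sphereConormalInv, hproj] using hdecomp

theorem isCompact_unitConormal_roundSphere (c : V) (E : Submodule ℝ V) :
    IsCompact (unitConormal (roundSphere c E)) :=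
  sphereConormalMap_image (c := c) (E := E) ▸
    ((isCompact_sphere 0 1).prod (isCompact_sphere 0 1)).image
      contDiff_sphereConormalMap.continuous

theorem isSmoothSubmanifold_unitConormal_roundSphere {k l : ℕ} (c : V) {E : Submodule ℝ V}
    (hE : Module.finrank ℝ E = k + 1) (hV : Module.finrank ℝ V = k + l + 1) :
    IsSmoothSubmanifold (k + l) (unitConormal (roundSphere c E)) := by
  have : Fact (Module.finrank ℝ E = k + 1) := ⟨hE⟩
  have : Fact (Module.finrank ℝ (WithLp 2 (ℝ × Eᗮ)) = l + 1) := by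
    have h := E.finrank_add_finrank_orthogonal
    refine ⟨?_⟩
    rw [(WithLp.linearEquiv 2 ℝ (ℝ × Eᗮ)).finrank_eq, Module.finrank_prod, Module.finrank_self]
    lia
  rw [← sphereConormalMap_image]
  exact (isSmoothSubmanifold_sphere.prod isSmoothSubmanifold_sphere).image
    ⟨contDiff_sphereConormalMap.contDiffOn, sphereConormalInv c E,
      contDiff_sphereConormalInv.contDiffOn, fun y hy =>
        sphereConormalInv_sphereConormalMap (mem_sphere_zero_iff_norm.1 hy.1)⟩

theorem IsSphereUnion.isSmoothSubmanifold_unitConormal {k l : ℕ} {K : Set V}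
    (hK : IsSphereUnion (k + 1) K) (hV : Module.finrank ℝ V = k + l + 1) :
    IsSmoothSubmanifold (k + l) (unitConormal K) :=
  isSmoothSubmanifold_of_eventually fun x hx => by
    obtain ⟨c, E, hE, -, h⟩ := hK x.1 hx.1.1
    exact ⟨_, isSmoothSubmanifold_unitConormal_roundSphere c hE hV,
      (eventually_mem_unitConormal_iff h)⟩

end Spheres

section Covering

variable {E X Y : Type*} [TopologicalSpace E] [TopologicalSpace X] [TopologicalSpace Y]

theorem isCoveringMap_pullback {p : E → X} (hp : IsCoveringMap p) {g : Y → X}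
    (hg : Continuous g) : IsCoveringMap fun z : {z : E × Y // p z.1 = g z.2} => z.1.2 := by
  intro y
  obtain ⟨hI, U, hyU, hU, -, H, hH⟩ := hp (g y)
  have hHsymm (w) : p (H.symm w) = w.1 := by rw [← hH, H.apply_symm_apply]
  have hmem (z : {z : E × Y // p z.1 = g z.2}) (hz : g z.1.2 ∈ U) : z.1.1 ∈ p ⁻¹' U := by
    rwa [mem_preimage, z.2]
  refine IsEvenlyCovered.to_isEvenlyCovered_preimage (I := p ⁻¹' {g y})
    ⟨hI, g ⁻¹' U, hyU, hU.preimage hg, (hU.preimage hg).preimage (by fun_prop), {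
      toFun := fun z => (⟨z.1.1.2, z.2⟩, (H ⟨z.1.1.1, hmem z.1 z.2⟩).2)
      invFun := fun w => ⟨⟨(H.symm (⟨g w.1, w.1.2⟩, w.2), w.1), hHsymm _⟩, w.1.2⟩
      left_inv := ?_
      right_inv := fun w => ?_
      continuous_toFun := by fun_prop
      continuous_invFun := by fun_prop }, fun _ => rfl⟩
  · rintro ⟨⟨⟨e, y'⟩, hz⟩, hz'⟩
    have hHe : (⟨g y', hz'⟩, (H ⟨e, hmem ⟨⟨e, y'⟩, hz⟩ hz'⟩).2) =
        H ⟨e, hmem ⟨⟨e, y'⟩, hz⟩ hz'⟩ := Prod.ext (Subtype.ext ((hH _).trans hz).symm) rfl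
    refine Subtype.ext (Subtype.ext (Prod.ext ?_ rfl))
    simp only [hHe, H.symm_apply_apply]
  · refine Prod.ext rfl ?_
    simp only [Subtype.coe_eta, H.apply_symm_apply]

theorem exists_homeomorph_lift {p : E → X} (hp : IsCoveringMap p)
    (H H' : C(unitInterval × X, X)) (h0 : ∀ x, H (0, x) = x)
    (hl : ∀ s x, H' (s, H (s, x)) = x) (hr : ∀ s x, H (s, H' (s, x)) = x) :
    ∃ Θ : E ≃ₜ E, ∀ y, p (Θ y) = H (1, p y) := by
  have h0' (x) : H' (0, x) = x := by rw [← h0 (H' (0, x)), hr]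
  let P : C(unitInterval × E, unitInterval × X) :=
    (ContinuousMap.id _).prodMap ⟨p, hp.continuous⟩
  let L := hp.liftHomotopy (H.comp P) (ContinuousMap.id E) fun y => h0 (p y)
  let L' := hp.liftHomotopy (H'.comp P) (ContinuousMap.id E) fun y => h0' (p y)
  have hL (s y) : p (L (s, y)) = H (s, p y) :=
    congrFun (hp.liftHomotopy_lifts (H.comp P) (ContinuousMap.id E) fun y => h0 (p y)) (s, y)
  have hL' (s y) : p (L' (s, y)) = H' (s, p y) :=
    congrFun (hp.liftHomotopy_lifts (H'.comp P) (ContinuousMap.id E) fun y => h0' (p y)) (s, y)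
  have hL0 (y) : L (0, y) = y := hp.liftHomotopy_zero _ _ _ y
  have hL0' (y) : L' (0, y) = y := hp.liftHomotopy_zero _ _ _ y
  -- the composites of the two lifts lift constant paths, hence are constant in `s`
  have hleft (y) : L' (1, L (1, y)) = y := by
    have h := hp.const_of_comp (g := fun s : unitInterval => L' (s, L (s, y))) (by fun_prop)
      (fun s s' => by rw [hL', hL', hL, hL, hl, hl]) 1 0
    rwa [hL0, hL0'] at h
  have hright (y) : L (1, L' (1, y)) = y := by
    have h := hp.const_of_comp (g := fun s : unitInterval => L (s, L' (s, y))) (by fun_prop)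
      (fun s s' => by rw [hL, hL, hL', hL', hr, hr]) 1 0
    rwa [hL0', hL0] at h
  exact ⟨⟨⟨fun y => L (1, y), fun y => L' (1, y), hleft, hright⟩, by fun_prop, by fun_prop⟩,
    fun y => hL 1 y⟩

theorem isHomeomorph_sumElim_val {s t : Set X} (hs : IsClosed s) (ht : IsClosed t)
    (h : IsCompl s t) : IsHomeomorph (Sum.elim Subtype.val Subtype.val : s ⊕ t → X) := by
  refine isHomeomorph_iff_continuous_isClosedMap_bijective.2
    ⟨by fun_prop, hs.isClosedMap_subtype_val.sumElim ht.isClosedMap_subtype_val,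
      Subtype.val_injective.sumElim Subtype.val_injective fun a b hab =>
        disjoint_left.1 h.disjoint a.2 (hab ▸ b.2), fun x => ?_⟩
  rcases h.codisjoint.top_le (mem_univ x) with hx | hx
  exacts [⟨Sum.inl ⟨x, hx⟩, rfl⟩, ⟨Sum.inr ⟨x, hx⟩, rfl⟩]

theorem continuous_symm_isometryEquiv {T X Y : Type*} [TopologicalSpace T]
    [PseudoMetricSpace X] [PseudoMetricSpace Y] {e : T → X ≃ᵢ Y}
    (he : Continuous fun z : T × X => e z.1 z.2) :
    Continuous fun z : T × Y => (e z.1).symm z.2 := by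
  refine continuous_iff_continuousAt.2 fun ⟨s₀, y₀⟩ => tendsto_iff_dist_tendsto_zero.2 ?_
  have hdist (z : T × Y) : dist ((e z.1).symm z.2) ((e s₀).symm y₀) =
      dist z.2 (e z.1 ((e s₀).symm y₀)) := by
    rw [← (e z.1).dist_eq, (e z.1).apply_symm_apply]
  have hcont : Continuous fun z : T × Y => dist z.2 (e z.1 ((e s₀).symm y₀)) :=
    continuous_snd.dist (he.comp (continuous_fst.prodMk continuous_const))
  simpa [hdist] using hcont.tendsto (s₀, y₀)

end Covering

section FrameCover

variable {V W : Type} {k l : ℕ}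

namespace FrameCover

/-- There is an isomorphism of the covers `σ` and `τ` over the map `e` of frames. -/
def IsoOver (σ : FrameCover.{u} V k) (τ : FrameCover.{u} W k)
    (e : V × (Fin k → V) → W × (Fin k → W)) : Prop :=
  ∃ Θ : σ.carrier ≃ₜ τ.carrier, ∀ y, τ.proj (Θ y) = e (σ.proj y)

/-- The part of the cover `σ` over the set `B` of frames. -/
def restrict (σ : FrameCover.{u} V k) (B : Set (V × (Fin k → V))) : FrameCover.{u} V k where
  carrier := σ.proj ⁻¹' B
  proj y := σ.proj y

theorem IsoOver.restrict {σ : FrameCover.{u} V k} {τ : FrameCover.{u} W k}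
    {e : V × (Fin k → V) → W × (Fin k → W)} {B : Set (V × (Fin k → V))}
    {B' : Set (W × (Fin k → W))} (h : σ.IsoOver τ e) (hB : ∀ a, e a ∈ B' ↔ a ∈ B) :
    (σ.restrict B).IsoOver (τ.restrict B') e := by
  obtain ⟨Θ, hΘ⟩ := h
  refine ⟨Θ.subtype fun y => ?_, fun y => hΘ y.1⟩
  rw [mem_preimage, mem_preimage, hΘ, hB]

theorem IsoOver.restrict_pullback {V' W' : Type} [NormedAddCommGroup V'] [NormedAddCommGroup W']
    {σ : FrameCover.{u} V k}
    {τ : FrameCover.{u} W k} {e : V × (Fin k → V) ≃ W × (Fin k → W)}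
    {C : Set (V × (Fin k → V))} {C' : Set (W × (Fin k → W))}
    (h : (σ.restrict C).IsoOver (τ.restrict C') e)
    {A B : Set (V' × (Fin l → V'))} {A' B' : Set (W' × (Fin l → W'))}
    {φ : V' × (Fin l → V') → V × (Fin k → V)} {φ' : W' × (Fin l → W') → W × (Fin k → W)}
    {e' : V' × (Fin l → V') ≃ₜ W' × (Fin l → W')} (he' : ∀ a, e' a ∈ A' ∩ B' ↔ a ∈ A ∩ B)
    (hC : MapsTo φ (A ∩ B) C) (hC' : MapsTo φ' (A' ∩ B') C')
    (hφ : ∀ a ∈ A ∩ B, φ' (e' a) = e (φ a)) :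
    ((σ.pullback A φ).restrict B).IsoOver ((τ.pullback A' φ').restrict B') e' := by
  obtain ⟨Θ, hΘ⟩ := h
  have hΘsymm (y : (τ.restrict C').carrier) : e (σ.proj (Θ.symm y).1) = τ.proj y.1 := by
    have h := hΘ (Θ.symm y)
    rw [Θ.apply_symm_apply] at h
    exact h.symm
  have hmem (y : ((σ.pullback A φ).restrict B).carrier) : σ.proj y.1.1.1 ∈ C :=
    y.1.2.2 ▸ hC ⟨y.1.2.1, y.2⟩
  have hmem' (y : ((τ.pullback A' φ').restrict B').carrier) : τ.proj y.1.1.1 ∈ C' :=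
    y.1.2.2 ▸ hC' ⟨y.1.2.1, y.2⟩
  have hsymm (y : ((τ.pullback A' φ').restrict B').carrier) : e'.symm y.1.1.2 ∈ A ∩ B :=
    (he' _).1 ((e'.apply_symm_apply _).symm ▸ ⟨y.1.2.1, y.2⟩)
  refine ⟨{
    toFun := fun y => ⟨⟨((Θ ⟨y.1.1.1, hmem y⟩).1, e' y.1.1.2),
      ((he' _).2 ⟨y.1.2.1, y.2⟩).1, ?_⟩, ((he' _).2 ⟨y.1.2.1, y.2⟩).2⟩
    invFun := fun y => ⟨⟨((Θ.symm ⟨y.1.1.1, hmem' y⟩).1, e'.symm y.1.1.2),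
      (hsymm y).1, ?_⟩, (hsymm y).2⟩
    left_inv := fun y => Subtype.ext (Subtype.ext
      (Prod.ext (congrArg Subtype.val (Θ.symm_apply_apply _)) (e'.symm_apply_apply _)))
    right_inv := fun y => Subtype.ext (Subtype.ext
      (Prod.ext (congrArg Subtype.val (Θ.apply_symm_apply _)) (e'.apply_symm_apply _)))
    continuous_toFun := ?_
    continuous_invFun := ?_ }, fun y => rfl⟩
  · exact (hΘ ⟨y.1.1.1, hmem y⟩).trans
      ((congrArg e y.1.2.2).trans (hφ _ ⟨y.1.2.1, y.2⟩).symm)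
  · refine e.injective ((hΘsymm _).trans (y.1.2.2.trans ?_))
    rw [← hφ _ (hsymm y), e'.apply_symm_apply]
  · have hval : Continuous fun y : ((σ.pullback A φ).restrict B).carrier => y.1.1 :=
      continuous_subtype_val.comp continuous_subtype_val
    exact (((continuous_subtype_val.comp (Θ.continuous.comp
      ((continuous_fst.comp hval).subtype_mk hmem))).prodMk
      (e'.continuous.comp (continuous_snd.comp hval))).subtype_mk _).subtype_mk _
  · have hval : Continuous fun y : ((τ.pullback A' φ').restrict B').carrier => y.1.1 :=
      continuous_subtype_val.comp continuous_subtype_val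
    exact (((continuous_subtype_val.comp (Θ.symm.continuous.comp
      ((continuous_fst.comp hval).subtype_mk hmem'))).prodMk
      (e'.symm.continuous.comp (continuous_snd.comp hval))).subtype_mk _).subtype_mk _

theorem IsoOver.glue {σ : FrameCover.{u} V k} {τ : FrameCover.{u} W k}
    {e e₁ e₂ : V × (Fin k → V) → W × (Fin k → W)} {B₁ B₂ : Set (V × (Fin k → V))}
    {B₁' B₂' : Set (W × (Fin k → W))} (h₁ : (σ.restrict B₁).IsoOver (τ.restrict B₁') e₁)
    (h₂ : (σ.restrict B₂).IsoOver (τ.restrict B₂') e₂)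
    (hσ : IsHomeomorph (Sum.elim Subtype.val Subtype.val :
      (σ.restrict B₁).carrier ⊕ (σ.restrict B₂).carrier → σ.carrier))
    (hτ : IsHomeomorph (Sum.elim Subtype.val Subtype.val :
      (τ.restrict B₁').carrier ⊕ (τ.restrict B₂').carrier → τ.carrier))
    (he₁ : ∀ y, σ.proj y ∈ B₁ → e (σ.proj y) = e₁ (σ.proj y))
    (he₂ : ∀ y, σ.proj y ∈ B₂ → e (σ.proj y) = e₂ (σ.proj y)) : σ.IsoOver τ e := by
  obtain ⟨Θ₁, hΘ₁⟩ := h₁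
  obtain ⟨Θ₂, hΘ₂⟩ := h₂
  have hΘ : ∀ y, τ.proj (hτ.homeomorph _ (Θ₁.sumCongr Θ₂ y)) =
      e (σ.proj (hσ.homeomorph _ y)) := by
    rintro (y | y)
    exacts [(hΘ₁ y).trans (he₁ y.1 y.2).symm, (hΘ₂ y).trans (he₂ y.1 y.2).symm]
  refine ⟨(hσ.homeomorph _).symm.trans ((Θ₁.sumCongr Θ₂).trans (hτ.homeomorph _)), fun y => ?_⟩
  exact (hΘ _).trans (congrArg (e ∘ σ.proj) ((hσ.homeomorph _).apply_symm_apply y))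

variable [NormedAddCommGroup W] {σ : FrameCover.{u} V k} {A : Set (W × (Fin l → W))}
  {φ : W × (Fin l → W) → V × (Fin k → V)}

theorem mem_range_pullback_proj {a : W × (Fin l → W)} :
    a ∈ range (σ.pullback A φ).proj ↔ a ∈ A ∧ φ a ∈ range σ.proj := by
  constructor
  · rintro ⟨y, rfl⟩
    exact ⟨y.2.1, y.1.1, y.2.2⟩
  · rintro ⟨ha, e, he⟩
    exact ⟨⟨(e, a), ha, he⟩, rfl⟩

theorem ncard_pullback_proj_preimage {a : W × (Fin l → W)} (ha : a ∈ A) :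
    ((σ.pullback A φ).proj ⁻¹' {a}).ncard = (σ.proj ⁻¹' {φ a}).ncard := by
  refine ncard_congr (fun y _ => y.1.1) ?_ ?_ fun e he => ⟨⟨(e, a), ha, he⟩, rfl, rfl⟩
  · exact fun y hy => y.2.2.trans (congrArg φ hy)
  · exact fun y y' hy hy' h => Subtype.ext (Prod.ext h (Eq.trans (b := a) hy (Eq.symm hy')))

theorem isCoveringMap_pullback_proj [NormedAddCommGroup V]
    (hσ : IsCoveringMap (rangeFactorization σ.proj)) (hφ : ContinuousOn φ A) :
    IsCoveringMap (rangeFactorization (σ.pullback A φ).proj) := by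
  let g : range (σ.pullback A φ).proj → range σ.proj := fun a =>
    ⟨φ a, (mem_range_pullback_proj.1 a.2).2⟩
  have hg : Continuous g :=
    (hφ.mono fun a ha => (mem_range_pullback_proj.1 ha).1).domRestrict.subtype_mk _
  let e : (σ.pullback A φ).carrier ≃ₜ
      {z : σ.carrier × range (σ.pullback A φ).proj // rangeFactorization σ.proj z.1 = g z.2} :=
    { toFun := fun y => ⟨(y.1.1, ⟨y.1.2, y, rfl⟩), Subtype.ext y.2.2⟩
      invFun := fun z => ⟨(z.1.1, z.1.2), (mem_range_pullback_proj.1 z.1.2.2).1,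
        congrArg Subtype.val z.2⟩
      continuous_toFun := ((continuous_fst.comp continuous_subtype_val).prodMk
        ((continuous_snd.comp continuous_subtype_val).subtype_mk _)).subtype_mk _
      continuous_invFun := ((continuous_fst.comp continuous_subtype_val).prodMk
        (continuous_subtype_val.comp (continuous_snd.comp continuous_subtype_val))).subtype_mk _ }
  exact (isCoveringMap_pullback hσ hg).comp_homeomorph e

end FrameCover

end FrameCover

section SpinStructure

variable {V W : Type} [NormedAddCommGroup V] [NormedSpace ℝ V]
  [NormedAddCommGroup W] [NormedSpace ℝ W] {k l : ℕ}

theorem sum_smul_mem_frameBundle {S : Set V} {x : V} {f : Fin k → V}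
    {g : Matrix (Fin k) (Fin k) ℝ} (h : (x, f) ∈ frameBundle S k) (hg : g.det ≠ 0) :
    (x, fun j => ∑ i, g i j • f i) ∈ frameBundle S k := by
  have hunit : IsUnit g := (Matrix.isUnit_iff_isUnit_det g).2 (isUnit_iff_ne_zero.2 hg)
  have hcomp : Fintype.linearCombination ℝ (fun j => ∑ i, g i j • f i) =
      Fintype.linearCombination ℝ f ∘ₗ g.mulVecLin := by
    ext j
    simp [Fintype.linearCombination_apply, Pi.single_apply]
  refine ⟨h.1, ?_, ?_⟩
  · rw [linearIndependent_iff_injective_fintypeLinearCombination, hcomp]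
    exact (linearIndependent_iff_injective_fintypeLinearCombination.1 h.2.1).comp
      (Matrix.mulVec_injective_iff_isUnit.2 hunit)
  · rw [← h.2.2, ← Fintype.range_linearCombination, ← Fintype.range_linearCombination, hcomp]
    exact LinearMap.range_comp_of_range_eq_top _
      (LinearMap.range_eq_top.2 (Matrix.mulVec_surjective_iff_isUnit.2 hunit))

theorem map_rotateFrame (L : V →ₗ[ℝ] W) (i j : Fin k) (θ : ℝ) (f : Fin k → V) :
    (fun m => L (rotateFrame i j θ f m)) = rotateFrame i j θ fun m => L (f m) := by
  ext m
  simp only [rotateFrame, Function.update_apply]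
  split_ifs <;> simp only [map_add, map_smul]

theorem cons_rotateFrame (v : V) (i j : Fin k) (θ : ℝ) (f : Fin k → V) :
    (Fin.cons v (rotateFrame i j θ f) : Fin (k + 1) → V) =
      rotateFrame i.succ j.succ θ (Fin.cons v f : Fin (k + 1) → V) := by
  simp only [rotateFrame, Fin.cons_update, Fin.cons_succ]

theorem exists_det_eq_cons_sum_smul (v : V) (f : Fin k → V) (g : Matrix (Fin k) (Fin k) ℝ) :
    ∃ g' : Matrix (Fin (k + 1)) (Fin (k + 1)) ℝ, g'.det = g.det ∧
      (Fin.cons v fun j => ∑ i, g i j • f i : Fin (k + 1) → V) =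
        fun j => ∑ i, g' i j • (Fin.cons v f : Fin (k + 1) → V) i := by
  refine ⟨Matrix.of (Fin.cons (Fin.cons 1 0) fun i => Fin.cons 0 (g i)), ?_, funext fun j => ?_⟩
  · rw [Matrix.det_succ_row_zero, Fin.sum_univ_succ]
    simp only [Nat.succ_eq_add_one, Fin.coe_ofNat_eq_mod, Nat.zero_mod, pow_zero, Matrix.of_apply,
      Fin.cons_zero, mul_one, Matrix.submatrix, Fin.zero_succAbove, Fin.cons_succ, one_mul,
      Fin.val_succ, Pi.zero_apply, mul_zero, zero_mul, Finset.sum_const_zero, add_zero]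
    rfl
  · induction j using Fin.cases <;> simp [Fin.sum_univ_succ]

theorem IsSpinStructure.pullback {S : Set V} {σ : FrameCover.{u} V k}
    (hσ : IsSpinStructure S σ) {S' : Set W} {φ : W × (Fin l → W) → V × (Fin k → V)}
    (hφ : MapsTo φ (frameBundle S' l) (frameBundle S k))
    (hcont : ContinuousOn φ (frameBundle S' l))
    (hdet : ∀ (x : W) (f : Fin l → W) (g : Matrix (Fin l) (Fin l) ℝ),
      ∃ g' : Matrix (Fin k) (Fin k) ℝ, g'.det = g.det ∧
        φ (x, fun j => ∑ i, g i j • f i) =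
          ((φ (x, f)).1, fun j => ∑ i, g' i j • (φ (x, f)).2 i))
    {ι : Fin l → Fin k} (hι : Function.Injective ι)
    (hrot : ∀ (x : W) (f : Fin l → W) (i j : Fin l) (θ : ℝ),
      φ (x, rotateFrame i j θ f) = ((φ (x, f)).1, rotateFrame (ι i) (ι j) θ (φ (x, f)).2)) :
    IsSpinStructure S' (σ.pullback (frameBundle S' l) φ) where
  proj_mem y := y.2.1
  orientation x f g hf hg := by
    obtain ⟨g', hg', hφg⟩ := hdet x f g
    simp only [FrameCover.mem_range_pullback_proj, hφg, hf, sum_smul_mem_frameBundle hf hg,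
      true_and]
    rw [hσ.orientation (φ (x, f)).1 (φ (x, f)).2 g' (hφ hf) (by rwa [hg']), hg']
  isOpen_positive := by
    have hΦ : Continuous fun a : frameBundle S' l => (⟨φ a, hφ a.2⟩ : frameBundle S k) :=
      hcont.domRestrict.subtype_mk _
    convert hσ.isOpen_positive.preimage hΦ using 1
    ext a
    exact FrameCover.mem_range_pullback_proj.trans (and_iff_right a.2)
  isCoveringMap := FrameCover.isCoveringMap_pullback_proj hσ.isCoveringMap hcont
  two_sheeted a ha := by
    obtain ⟨ha, hφa⟩ := FrameCover.mem_range_pullback_proj.1 ha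
    exact (FrameCover.ncard_pullback_proj_preimage ha).trans (hσ.two_sheeted _ hφa)
  nontrivial_on_fibres i j hij γ hγ hclosed := by
    let γ' : C(unitInterval, σ.carrier) :=
      ⟨fun t => (γ t).1.1, continuous_fst.comp (continuous_subtype_val.comp γ.continuous)⟩
    have hproj (t) : σ.proj (γ' t) = φ ((σ.pullback (frameBundle S' l) φ).proj (γ t)) :=
      (γ t).2.2
    refine hσ.nontrivial_on_fibres (ι i) (ι j) (hι.ne hij) γ' (fun t => ?_)
      (congrArg (fun y => y.1.1) hclosed)
    rw [hproj, hproj, hγ, hrot]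

theorem IsSpinStructure.isClopen_positive {S : Set V} {σ : FrameCover.{u} V (k + 1)}
    (hσ : IsSpinStructure S σ) :
    IsClopen {a : frameBundle S (k + 1) | (a : V × (Fin (k + 1) → V)) ∈ range σ.proj} := by
  let g : Matrix (Fin (k + 1)) (Fin (k + 1)) ℝ := Matrix.diagonal (Fin.cons (-1) fun _ => 1)
  have hdet : g.det = -1 := by simp [g, Fin.prod_univ_succ]
  have hg : g.det ≠ 0 := by rw [hdet]; norm_num
  let flip : frameBundle S (k + 1) → frameBundle S (k + 1) := fun a =>
    ⟨(a.1.1, fun j => ∑ i, g i j • a.1.2 i), sum_smul_mem_frameBundle a.2 hg⟩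
  have hflip : Continuous flip := Continuous.subtype_mk (by fun_prop) _
  have hcompl : {a : frameBundle S (k + 1) | (a : V × (Fin (k + 1) → V)) ∈ range σ.proj}ᶜ =
      flip ⁻¹' {a | (a : V × (Fin (k + 1) → V)) ∈ range σ.proj} := by
    ext a
    have h := hσ.orientation a.1.1 a.1.2 g a.2 hg
    simp only [hdet, show ¬(0 : ℝ) < -1 by norm_num, iff_false] at h
    exact h.symm
  exact ⟨⟨hcompl ▸ hσ.isOpen_positive.preimage hflip⟩, hσ.isOpen_positive⟩

theorem IsSpinStructure.mem_range_of_continuous {T : Type*} [TopologicalSpace T]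
    [PreconnectedSpace T] {S : Set V} {σ : FrameCover.{u} V (k + 1)} (hσ : IsSpinStructure S σ)
    {c : T → V × (Fin (k + 1) → V)} (hc : Continuous c) (hcS : ∀ t, c t ∈ frameBundle S (k + 1))
    {t₀ : T} (h₀ : c t₀ ∈ range σ.proj) (t : T) : c t ∈ range σ.proj := by
  have h := (hσ.isClopen_positive.preimage (hc.subtype_mk hcS)).eq_univ ⟨t₀, h₀⟩
  exact h.symm.subset (mem_univ t)

theorem IsSpinStructure.isoOver_of_isotopy {S : Set V} {σ : FrameCover.{u} V (k + 1)}
    (hσ : IsSpinStructure S σ)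
    (e : unitInterval → V × (Fin (k + 1) → V) ≃ₜ V × (Fin (k + 1) → V))
    (he : Continuous fun z : unitInterval × (V × (Fin (k + 1) → V)) => e z.1 z.2)
    (he' : Continuous fun z : unitInterval × (V × (Fin (k + 1) → V)) => (e z.1).symm z.2)
    (heS : ∀ s a, e s a ∈ frameBundle S (k + 1) ↔ a ∈ frameBundle S (k + 1))
    (he0 : ∀ a, e 0 a = a) : σ.IsoOver σ (e 1) := by
  have hS (a : range σ.proj) : a.1 ∈ frameBundle S (k + 1) := by
    obtain ⟨_, y, rfl⟩ := a
    exact hσ.proj_mem y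
  have hS' (s) (a : range σ.proj) : (e s).symm a.1 ∈ frameBundle S (k + 1) := by
    rw [← heS s, (e s).apply_symm_apply]
    exact hS a
  have he0' (a) : (e 0).symm a = a := (e 0).symm_apply_eq.2 (he0 a).symm
  let H : C(unitInterval × range σ.proj, range σ.proj) :=
    ⟨fun z => ⟨e z.1 z.2, hσ.mem_range_of_continuous (c := fun s => e s z.2)
      (he.comp (continuous_id.prodMk continuous_const)) (fun s => (heS s _).2 (hS z.2))
      (t₀ := 0) (by rw [he0]; exact z.2.2) z.1⟩,
      (he.comp (continuous_id.prodMap continuous_subtype_val)).subtype_mk _⟩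
  let H' : C(unitInterval × range σ.proj, range σ.proj) :=
    ⟨fun z => ⟨(e z.1).symm z.2, hσ.mem_range_of_continuous (c := fun s => (e s).symm z.2)
      (he'.comp (continuous_id.prodMk continuous_const)) (fun s => hS' s z.2)
      (t₀ := 0) (by rw [he0']; exact z.2.2) z.1⟩,
      (he'.comp (continuous_id.prodMap continuous_subtype_val)).subtype_mk _⟩
  obtain ⟨Θ, hΘ⟩ := exists_homeomorph_lift hσ.isCoveringMap H H' (fun a => Subtype.ext (he0 a))
    (fun s a => Subtype.ext ((e s).symm_apply_apply a))
    (fun s a => Subtype.ext ((e s).apply_symm_apply a))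
  exact ⟨Θ, fun y => congrArg Subtype.val (hΘ y)⟩

end SpinStructure

section EuclideanSpin

variable {V : Type} [NormedAddCommGroup V] [InnerProductSpace ℝ V] {k : ℕ}

/-- The action of a rigid motion on frames of Euclidean space. -/
noncomputable abbrev rigidFrameHomeomorph {W : Type} [NormedAddCommGroup W]
    [InnerProductSpace ℝ W] (ρ : V ≃ᵃⁱ[ℝ] W) (k : ℕ) : V × (Fin k → V) ≃ₜ W × (Fin k → W) :=
  frameHomeomorph ρ.toHomeomorph ρ.linearIsometryEquiv.toContinuousLinearEquiv k

/-- The action of the cotangent lift of a rigid motion on frames of the cotangent bundle. -/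
noncomputable abbrev cotangentFrameHomeomorph {W : Type} [NormedAddCommGroup W]
    [InnerProductSpace ℝ W] (ρ : V ≃ᵃⁱ[ℝ] W) (k : ℕ) :
    (V × V) × (Fin k → V × V) ≃ₜ (W × W) × (Fin k → W × W) :=
  frameHomeomorph (cotangentLift ρ) (cotangentLiftDeriv ρ) k

theorem IsSpinStructure.isoOver_of_rigidIsotopy {σ : FrameCover.{u} V (k + 1)}
    (hσ : IsSpinStructure univ σ) (ρ : unitInterval → V ≃ᵃⁱ[ℝ] V)
    (hρ : Continuous fun z : unitInterval × V => ρ z.1 z.2) (hρ0 : ρ 0 = .refl ℝ V) :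
    σ.IsoOver σ (rigidFrameHomeomorph (ρ 1) (k + 1)) := by
  have hlin : Continuous fun z : unitInterval × V => (ρ z.1).linearIsometryEquiv z.2 := by
    have h (z : unitInterval × V) : (ρ z.1).linearIsometryEquiv z.2 = ρ z.1 z.2 - ρ z.1 0 := by
      simpa using (ρ z.1).map_vsub z.2 0
    simp only [h]
    exact hρ.sub (hρ.comp (continuous_fst.prodMk continuous_const))
  have hρ' := continuous_symm_isometryEquiv (e := fun s => (ρ s).toIsometryEquiv) hρ
  have hlin' := continuous_symm_isometryEquiv
    (e := fun s => (ρ s).linearIsometryEquiv.toIsometryEquiv) hlin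
  refine hσ.isoOver_of_isotopy (fun s => rigidFrameHomeomorph (ρ s) (k + 1)) ?_ ?_ (fun s a => ?_)
    fun a => by rw [hρ0]; rfl
  · exact (hρ.comp (by fun_prop : Continuous fun z : unitInterval × (V × (Fin (k + 1) → V)) =>
      (z.1, z.2.1))).prodMk (continuous_pi fun i =>
      hlin.comp (by fun_prop : Continuous fun z : unitInterval × (V × (Fin (k + 1) → V)) =>
        (z.1, z.2.2 i)))
  · exact (hρ'.comp (by fun_prop : Continuous fun z : unitInterval × (V × (Fin (k + 1) → V)) =>
      (z.1, z.2.1))).prodMk (continuous_pi fun i =>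
      hlin'.comp (by fun_prop : Continuous fun z : unitInterval × (V × (Fin (k + 1) → V)) =>
        (z.1, z.2.2 i)))
  · exact frameHomeomorph_mem_frameBundle_iff _ (hasFDerivAt_affineIsometryEquiv (ρ s) a.1)
      (.of_forall fun _ => Iff.rfl)

end EuclideanSpin

section ConormalCover

variable {V W : Type} [NormedAddCommGroup V] [InnerProductSpace ℝ V] [FiniteDimensional ℝ V]
  [NormedAddCommGroup W] [InnerProductSpace ℝ W] [FiniteDimensional ℝ W]
  {d k : ℕ} {K : Set V}

theorem IsSphereUnion.conormalIso_mem_frameBundle (hK : IsSphereUnion d K)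
    (hV : Module.finrank ℝ V = k) {a : (V × V) × (Fin k → V × V)}
    (ha : a ∈ frameBundle (conormal K) k) :
    (a.1.1, fun i => conormalIso K a.1 (a.2 i)) ∈ frameBundle (univ : Set V) k := by
  have hli : LinearIndependent ℝ fun i => conormalIso K a.1 (a.2 i) := by
    refine ha.2.1.map (f := conormalIso K a.1) ?_
    rw [ha.2.2, Submodule.disjoint_def]
    exact fun y hy hy0 => hK.eq_zero_of_conormalIso_eq_zero ha.1 hy hy0
  refine ⟨trivial, hli, ?_⟩
  rw [tangentSpace_univ]
  exact hli.span_eq_top_of_card_eq_finrank' (by rw [Fintype.card_fin, hV])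

theorem IsSphereUnion.isSpinStructure_conormalCover (hK : IsSphereUnion d K)
    (hV : Module.finrank ℝ V = k) {σ : FrameCover.{u} V k} (hσ : IsSpinStructure univ σ) :
    IsSpinStructure (conormal K) (conormalCover σ K) := by
  refine hσ.pullback (ι := id) (fun a ha => hK.conormalIso_mem_frameBundle hV ha) ?_
    (fun x f g => ⟨g, rfl, by simp only [map_sum, map_smul]⟩) Function.injective_id
    fun x f i j θ => Prod.ext rfl (map_rotateFrame (conormalIso K x) i j θ f)
  refine ContinuousOn.prodMk (by fun_prop) (continuousOn_pi.2 fun i => ?_)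
  exact hK.continuousOn_conormalIso.comp
    (f := fun a : (V × V) × (Fin k → V × V) => (a.1, a.2 i)) (by fun_prop) fun a ha => ha.1.1

omit [FiniteDimensional ℝ V] in
theorem radial_notMem_tangentSpace_unitConormal {x : V × V} (hx : x ∈ unitConormal K) :
    (0, x.2) ∉ tangentSpace (unitConormal K) x := by
  intro hmem
  have h := apply_eq_zero_of_mem_tangentSpace (c := 1)
    (hasFDerivAt_snd (𝕜 := ℝ) (p := x)).norm_sq.hasFDerivWithinAt hx
    (fun y hy => by rw [show ‖y.2‖ = 1 from hy.2, one_pow]) hmem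
  simp [show ‖x.2‖ = 1 from hx.2] at h

omit [FiniteDimensional ℝ V] in
theorem radial_mem_tangentSpace_conormal {x : V × V} (hx : x ∈ conormal K) :
    (0, x.2) ∈ tangentSpace (conormal K) x := by
  have hderiv : HasDerivAt (fun t : ℝ => (x.1, (1 + t) • x.2)) ((0 : V), x.2) 0 :=
    (hasDerivAt_const _ _).prodMk
      (by simpa using ((hasDerivAt_id (0 : ℝ)).const_add 1).smul_const x.2)
  simpa using deriv_mem_tangentSpace (S := conormal K) hderiv fun t =>
    ⟨hx.1, fun v hv => by rw [inner_smul_left, hx.2 v hv, mul_zero]⟩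

theorem IsSphereUnion.cons_mem_frameBundle (hK : IsSphereUnion d K)
    (hV : Module.finrank ℝ V = k + 1) {a : (V × V) × (Fin k → V × V)}
    (ha : a ∈ frameBundle (unitConormal K) k) :
    (a.1, (Fin.cons (0, a.1.2) a.2 : Fin (k + 1) → V × V)) ∈
      frameBundle (conormal K) (k + 1) := by
  have hli : LinearIndependent ℝ (Fin.cons (0, a.1.2) a.2 : Fin (k + 1) → V × V) :=
    linearIndependent_finCons.2 ⟨ha.2.1, ha.2.2 ▸ radial_notMem_tangentSpace_unitConormal ha.1⟩
  refine ⟨ha.1.1, hli, Submodule.eq_of_le_of_finrank_le ?_ ?_⟩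
  · rw [Submodule.span_le, Fin.range_cons, insert_subset_iff]
    exact ⟨radial_mem_tangentSpace_conormal ha.1.1, Submodule.span_le.1
      (ha.2.2.trans_le (tangentSpace_mono inter_subset_left a.1))⟩
  · rw [finrank_span_eq_card hli, Fintype.card_fin]
    exact (hK.finrank_tangentSpace_conormal_le ha.1.1).trans hV.le

theorem IsSphereUnion.isSpinStructure_unitConormalCover (hK : IsSphereUnion d K)
    (hV : Module.finrank ℝ V = k + 1) {σ : FrameCover.{u} V (k + 1)}
    (hσ : IsSpinStructure univ σ) :
    IsSpinStructure (unitConormal K) (unitConormalCover σ K) := by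
  refine (hK.isSpinStructure_conormalCover hV hσ).pullback (ι := Fin.succ)
    (fun a ha => hK.cons_mem_frameBundle hV ha) ?_ (fun x f g => ?_) (Fin.succ_injective k)
    fun x f i j θ => Prod.ext rfl (cons_rotateFrame (0, x.2) i j θ f)
  · refine (Continuous.prodMk (by fun_prop) (continuous_pi fun i => ?_)).continuousOn
    induction i using Fin.cases with
    | zero => simp only [Fin.cons_zero]; fun_prop
    | succ i => simp only [Fin.cons_succ]; fun_prop
  · obtain ⟨g', hdet, hg'⟩ := exists_det_eq_cons_sum_smul (0, x.2) f g
    exact ⟨g', hdet, Prod.ext rfl hg'⟩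

theorem isoOver_conormalCover_restrict {σ : FrameCover.{u} V k} {τ : FrameCover.{u} W k}
    {ρ : V ≃ᵃⁱ[ℝ] W} (hρ : σ.IsoOver τ (rigidFrameHomeomorph ρ k)) {P : Set V} {K' P' : Set W}
    (hP : ∀ y, ρ y ∈ P' ↔ y ∈ P) (hK : ∀ q ∈ P, ∀ᶠ y in 𝓝 q, ρ y ∈ K' ↔ y ∈ K) :
    ((conormalCover σ K).restrict {a | a.1.1 ∈ P}).IsoOver
      ((conormalCover τ K').restrict {a | a.1.1 ∈ P'}) (cotangentFrameHomeomorph ρ k) := by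
  refine (hρ.restrict (B := {a | a.1 ∈ P}) (B' := {a | a.1 ∈ P'}) fun a => hP a.1).restrict_pullback
    (e := (rigidFrameHomeomorph ρ k).toEquiv) (fun a => ?_) (fun a ha => ha.2) (fun a ha => ha.2)
    fun a ha => Prod.ext rfl (funext fun i => conormalIso_cotangentLift (hK _ ha.2) (a.2 i))
  refine (and_congr_right' (hP a.1.1)).trans (and_congr_left fun ha => ?_)
  exact frameHomeomorph_mem_frameBundle_iff _ (hasFDerivAt_cotangentLift ρ a.1)
    (eventually_cotangentLift_mem_conormal_iff (hK _ ha))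

theorem isoOver_unitConormalCover_restrict {σ : FrameCover.{u} V (k + 1)}
    {τ : FrameCover.{u} W (k + 1)} {ρ : V ≃ᵃⁱ[ℝ] W}
    (hρ : σ.IsoOver τ (rigidFrameHomeomorph ρ (k + 1))) {P : Set V} {K' P' : Set W}
    (hP : ∀ y, ρ y ∈ P' ↔ y ∈ P) (hK : ∀ q ∈ P, ∀ᶠ y in 𝓝 q, ρ y ∈ K' ↔ y ∈ K) :
    ((unitConormalCover σ K).restrict {a | a.1.1 ∈ P}).IsoOver
      ((unitConormalCover τ K').restrict {a | a.1.1 ∈ P'}) (cotangentFrameHomeomorph ρ k) := by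
  refine (isoOver_conormalCover_restrict hρ hP hK).restrict_pullback
    (e := (cotangentFrameHomeomorph ρ (k + 1)).toEquiv) (fun a => ?_) (fun a ha => ha.2)
    (fun a ha => ha.2) fun a _ => Prod.ext rfl (funext fun i => ?_)
  · refine (and_congr_right' (hP a.1.1)).trans (and_congr_left fun ha => ?_)
    exact frameHomeomorph_mem_frameBundle_iff _ (hasFDerivAt_cotangentLift ρ a.1)
      (eventually_cotangentLift_mem_unitConormal_iff (hK _ ha))
  · induction i using Fin.cases <;> simp

theorem isHomeomorph_sumElim_restrict_unitConormalCover {σ : FrameCover.{u} V (k + 1)}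
    {P Q : Set V} (hP : IsClosed P) (hQ : IsClosed Q) (hd : Disjoint P Q) :
    IsHomeomorph (Sum.elim Subtype.val Subtype.val :
      ((unitConormalCover σ (P ∪ Q)).restrict {a | a.1.1 ∈ P}).carrier ⊕
        ((unitConormalCover σ (P ∪ Q)).restrict {a | a.1.1 ∈ Q}).carrier →
      (unitConormalCover σ (P ∪ Q)).carrier) := by
  have hcont : Continuous fun y : (unitConormalCover σ (P ∪ Q)).carrier => y.1.2.1.1 :=
    continuous_fst.comp (continuous_fst.comp (continuous_snd.comp continuous_subtype_val))
  refine isHomeomorph_sumElim_val (hP.preimage hcont) (hQ.preimage hcont)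
    ⟨hd.preimage _, codisjoint_iff_le_sup.2 fun y _ => y.2.1.1.1.1⟩

theorem isoOver_unitConormalCover_union {σ : FrameCover.{u} V (k + 1)} {P Q : Set V}
    (hP : IsClosed P) (hQ : IsClosed Q) {ρ : V ≃ᵃⁱ[ℝ] V} (hd : Disjoint P Q)
    (hd' : Disjoint P (ρ '' Q)) (hρ : σ.IsoOver σ (rigidFrameHomeomorph ρ (k + 1)))
    {e : (V × V) × (Fin k → V × V) → (V × V) × (Fin k → V × V)}
    (heP : ∀ a ∈ frameBundle (unitConormal (P ∪ Q)) k, a.1.1 ∈ P → e a = a)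
    (heQ : ∀ a ∈ frameBundle (unitConormal (P ∪ Q)) k, a.1.1 ∈ Q →
      e a = cotangentFrameHomeomorph ρ k a) :
    (unitConormalCover σ (P ∪ Q)).IsoOver (unitConormalCover σ (P ∪ ρ '' Q)) e := by
  have hρQ : IsClosed (ρ '' Q) := ρ.toHomeomorph.isClosed_image.2 hQ
  have hrefl : σ.IsoOver σ (rigidFrameHomeomorph (.refl ℝ V) (k + 1)) := ⟨.refl _, fun _ => rfl⟩
  refine FrameCover.IsoOver.glue
    (isoOver_unitConormalCover_restrict hrefl (K' := P ∪ ρ '' Q) (fun _ => Iff.rfl)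
      fun q hq => ?_)
    (isoOver_unitConormalCover_restrict hρ (K' := P ∪ ρ '' Q)
      (fun _ => ρ.injective.mem_set_image) fun q hq => ?_)
    (isHomeomorph_sumElim_restrict_unitConormalCover hP hQ hd)
    (isHomeomorph_sumElim_restrict_unitConormalCover hP hρQ hd')
    (fun y hy => heP _ y.2.1 hy) fun y hy => heQ _ y.2.1 hy
  · filter_upwards [eventually_mem_union_iff_left hQ hd hq,
      eventually_mem_union_iff_left hρQ hd' hq] with y hy hy'
    exact hy'.trans hy.symm
  · filter_upwards [eventually_mem_union_iff_right hP hd hq,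
      ρ.continuous.continuousAt.eventually
        (eventually_mem_union_iff_right hP hd' (mem_image_of_mem ρ hq))] with y hy hy'
    exact hy'.trans (ρ.injective.mem_set_image.trans hy.symm)

end ConormalCover

section Isotopy

variable {V W : Type} [NormedAddCommGroup V] [NormedSpace ℝ V]
  [NormedAddCommGroup W] [NormedSpace ℝ W]

theorem contDiffOn_union_of_isClosed {f : V → W} {S T : Set V} (hS : IsClosed S) (hT : IsClosed T)
    (hd : Disjoint S T) (hfS : ContDiffOn ℝ ∞ f S) (hfT : ContDiffOn ℝ ∞ f T) :
    ContDiffOn ℝ ∞ f (S ∪ T) := by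
  rintro x (hx | hx)
  · refine (hfS x hx).congr_set (EventuallyEq.symm ?_)
    exact (eventually_mem_union_iff_left hT hd hx).mono fun y hy => propext hy
  · refine (hfT x hx).congr_set (EventuallyEq.symm ?_)
    exact (eventually_mem_union_iff_right hS hd hx).mono fun y hy => propext hy

theorem IsSmoothEmbeddingOn.congr {f f' : V → W} {S : Set V} (hf : IsSmoothEmbeddingOn f S)
    (h : EqOn f' f S) : IsSmoothEmbeddingOn f' S := by
  obtain ⟨hcont, g, hg, hgl⟩ := hf
  refine ⟨hcont.congr h, g, by rwa [h.image_eq], fun x hx => ?_⟩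
  rw [h hx, hgl hx]

theorem IsSmoothEmbeddingOn.union {f : V → W} {S T : Set V} (hS : IsCompact S) (hT : IsCompact T)
    (hd : Disjoint S T) (hfS : IsSmoothEmbeddingOn f S) (hfT : IsSmoothEmbeddingOn f T)
    (hd' : Disjoint (f '' S) (f '' T)) : IsSmoothEmbeddingOn f (S ∪ T) := by
  classical
  obtain ⟨hcont, g, hg, hgl⟩ := hfS
  obtain ⟨hcont', g', hg', hgl'⟩ := hfT
  refine ⟨contDiffOn_union_of_isClosed hS.isClosed hT.isClosed hd hcont hcont',
    fun y => if y ∈ f '' S then g y else g' y, ?_, ?_⟩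
  · rw [image_union]
    refine contDiffOn_union_of_isClosed (hS.image_of_continuousOn hcont.continuousOn).isClosed
      (hT.image_of_continuousOn hcont'.continuousOn).isClosed hd' ?_ ?_
    · exact hg.congr fun y hy => if_pos hy
    · exact hg'.congr fun y hy => if_neg (disjoint_right.1 hd' hy)
  · rintro x (hx | hx)
    · simp only [mem_image_of_mem f hx, if_true, hgl hx]
    · simp only [disjoint_right.1 hd' (mem_image_of_mem f hx), if_false, hgl' hx]

/-- `F s`, `s ∈ [0,1]`, is a smooth isotopy of `S` in `N` that starts at the inclusion. -/
structure IsIsotopyIn (N S : Set V) (F : ℝ → V → V) : Prop where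
  contDiffOn : ContDiffOn ℝ ∞ (Function.uncurry F) (Icc (0 : ℝ) 1 ×ˢ S)
  isSmoothEmbeddingOn : ∀ s ∈ Icc (0 : ℝ) 1, IsSmoothEmbeddingOn (F s) S
  mapsTo : ∀ s ∈ Icc (0 : ℝ) 1, MapsTo (F s) S N
  zero : EqOn (F 0) id S

namespace IsIsotopyIn

variable {N S T : Set V} {F F' : ℝ → V → V}

theorem id (h : S ⊆ N) : IsIsotopyIn N S fun _ => _root_.id where
  contDiffOn := contDiff_snd.contDiffOn
  isSmoothEmbeddingOn _ _ :=
    ⟨contDiff_id.contDiffOn, _root_.id, contDiff_id.contDiffOn, fun _ _ => rfl⟩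
  mapsTo _ _ := h
  zero _ _ := rfl

theorem congr (hF : IsIsotopyIn N S F) (h : ∀ s, EqOn (F' s) (F s) S) : IsIsotopyIn N S F' where
  contDiffOn := hF.contDiffOn.congr fun x hx => h x.1 hx.2
  isSmoothEmbeddingOn s hs := (hF.isSmoothEmbeddingOn s hs).congr (h s)
  mapsTo s hs := (hF.mapsTo s hs).congr (h s).symm
  zero := (h 0).trans hF.zero

theorem union (hS : IsCompact S) (hT : IsCompact T) (hFS : IsIsotopyIn N S F)
    (hFT : IsIsotopyIn N T F) (hd : ∀ s ∈ Icc (0 : ℝ) 1, Disjoint (F s '' S) (F s '' T)) :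
    IsIsotopyIn N (S ∪ T) F := by
  have hST : Disjoint S T := by
    simpa only [hFS.zero.image_eq, hFT.zero.image_eq, image_id] using
      hd 0 (left_mem_Icc.2 zero_le_one)
  refine ⟨?_, fun s hs => ?_, fun s hs => ?_, eqOn_union.2 ⟨hFS.zero, hFT.zero⟩⟩
  · rw [prod_union]
    exact contDiffOn_union_of_isClosed (isClosed_Icc.prod hS.isClosed)
      (isClosed_Icc.prod hT.isClosed) (hST.set_prod_right _ _) hFS.contDiffOn hFT.contDiffOn
  · exact (hFS.isSmoothEmbeddingOn s hs).union hS hT hST (hFT.isSmoothEmbeddingOn s hs) (hd s hs)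
  · exact (hFS.mapsTo s hs).union (hFT.mapsTo s hs)

end IsIsotopyIn

theorem fderivWithin_frame_eq {k : ℕ} {S : Set V} {f g : V → W} {g' : V →L[ℝ] W}
    {a : V × (Fin k → V)} (ha : a ∈ frameBundle S k) (hg : HasFDerivAt g g' a.1)
    (h : ∀ᶠ y in 𝓝 a.1, y ∈ S → f y = g y) :
    (f a.1, fun i => fderivWithin ℝ f S a.1 (a.2 i)) = (g a.1, fun i => g' (a.2 i)) := by
  have hfg : f =ᶠ[𝓝[S] a.1] g := eventually_nhdsWithin_iff.2 h
  have hf : HasFDerivWithinAt f g' S a.1 :=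
    hg.hasFDerivWithinAt.congr_of_eventuallyEq hfg (h.self_of_nhds ha.1)
  exact Prod.ext (h.self_of_nhds ha.1) (funext fun i =>
    fderivWithin_apply_of_mem_tangentSpace hf (apply_mem_tangentSpace_of_mem_frameBundle ha i))

end Isotopy

section ConormalIsotopy

variable {V : Type} [NormedAddCommGroup V] [InnerProductSpace ℝ V] [FiniteDimensional ℝ V]

theorem spinIsotopic_of_isIsotopyIn {k : ℕ} {σ : FrameCover.{u} V (k + 1)} {P Q : Set V}
    (hP : IsClosed P) (hQ : IsClosed Q) (hPc : IsCompact (unitConormal P))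
    (hQc : IsCompact (unitConormal Q)) {ρ : V ≃ᵃⁱ[ℝ] V} (hd : Disjoint P Q)
    (hd' : Disjoint P (ρ '' Q)) (hρ : σ.IsoOver σ (rigidFrameHomeomorph ρ (k + 1)))
    {m : ℝ → V × V → V × V} (hm : IsIsotopyIn (unitCotangent V) (unitConormal Q) m)
    (hmd : ∀ s ∈ Icc (0 : ℝ) 1, ∀ x ∈ unitConormal Q, m s x ∉ unitConormal P)
    (hm1 : EqOn (m 1) (cotangentLift ρ) (unitConormal Q)) :
    SpinIsotopic (unitCotangent V) (unitConormal (P ∪ Q)) (unitConormal (P ∪ ρ '' Q))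
      (unitConormalCover σ (P ∪ Q)) (unitConormalCover σ (P ∪ ρ '' Q)) := by
  classical
  let F : ℝ → V × V → V × V := fun s x => if x.1 ∈ Q then m s x else x
  have hFP (s) : EqOn (F s) id (unitConormal P) := fun x hx => if_neg (disjoint_left.1 hd hx.1.1)
  have hFQ (s) : EqOn (F s) (m s) (unitConormal Q) := fun x hx => if_pos hx.1.1
  have hF : IsIsotopyIn (unitCotangent V) (unitConormal (P ∪ Q)) F := by
    rw [unitConormal_union hP hQ hd]
    refine ((IsIsotopyIn.id inter_subset_right).congr hFP).union hPc hQc (hm.congr hFQ)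
      fun s hs => ?_
    rw [(hFP s).image_eq, (hFQ s).image_eq, image_id, disjoint_right, forall_mem_image]
    exact hmd s hs
  have hρQ : IsClosed (ρ '' Q) := ρ.toHomeomorph.isClosed_image.2 hQ
  have himage : F 1 '' unitConormal (P ∪ Q) = unitConormal (P ∪ ρ '' Q) := by
    rw [unitConormal_union hP hQ hd, unitConormal_union hP hρQ hd', image_union,
      (hFP 1).image_eq, image_id, ((hFQ 1).trans hm1).image_eq, cotangentLift_image_unitConormal]
  have hiso : (unitConormalCover σ (P ∪ Q)).IsoOver (unitConormalCover σ (P ∪ ρ '' Q)) fun a =>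
      (F 1 a.1, fun i => fderivWithin ℝ (F 1) (unitConormal (P ∪ Q)) a.1 (a.2 i)) := by
    refine isoOver_unitConormalCover_union hP hQ hd hd' hρ (fun a ha haP => ?_) fun a ha haQ => ?_
    · refine fderivWithin_frame_eq ha (hasFDerivAt_id a.1) ?_
      filter_upwards [eventually_mem_unitConormal_iff (eventually_mem_union_iff_left hQ hd haP)]
        with y hy hyPQ
      exact hFP 1 (hy.1 hyPQ)
    · refine fderivWithin_frame_eq ha (hasFDerivAt_cotangentLift ρ a.1) ?_
      filter_upwards [eventually_mem_unitConormal_iff (eventually_mem_union_iff_right hP hd haQ)]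
        with y hy hyPQ
      exact (hFQ 1).trans hm1 (hy.1 hyPQ)
  exact ⟨F, hF.contDiffOn, fun s hs => ⟨hF.isSmoothEmbeddingOn s hs, hF.mapsTo s hs⟩, hF.zero,
    himage, hiso⟩

end ConormalIsotopy

section Push

theorem add_ne_zero_of_norm_lt_one {V : Type} [NormedAddCommGroup V] {w p : V} (hw : ‖w‖ < 1)
    (hp : ‖p‖ = 1) : p + w ≠ 0 := fun h => by
  rw [eq_neg_of_add_eq_zero_left h, norm_neg] at hp
  exact hw.ne hp

variable {V : Type} [NormedAddCommGroup V] [InnerProductSpace ℝ V]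

/-- The map of the unit sphere that pushes each point in the direction `w`. -/
noncomputable def push (w p : V) : V := NormedSpace.normalize (p + w)

/-- The inverse of `push w` for `‖w‖ < 1`: the factor of `p` is the positive `r` with
`‖r • p - w‖ = 1`. -/
noncomputable def unpush (w p : V) : V :=
  (⟪p, w⟫_ℝ + √(⟪p, w⟫_ℝ ^ 2 + (1 - ‖w‖ ^ 2))) • p - w

variable {w p : V}

theorem norm_push (hw : ‖w‖ < 1) (hp : ‖p‖ = 1) : ‖push w p‖ = 1 :=
  NormedSpace.norm_normalize_eq_one_iff.2 (add_ne_zero_of_norm_lt_one hw hp)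

theorem push_zero (hp : ‖p‖ = 1) : push 0 p = p := by
  rw [push, add_zero, NormedSpace.normalize_eq_self_of_norm_eq_one hp]

theorem inner_push_nonneg (hw : ‖w‖ ≤ 1) (hp : ‖p‖ = 1) : 0 ≤ ⟪push w p, p⟫_ℝ := by
  have h : -1 ≤ ⟪w, p⟫_ℝ := by
    have := (abs_le.1 (abs_real_inner_le_norm w p)).1
    rw [hp, mul_one] at this
    linarith
  rw [push, NormedSpace.normalize, real_inner_smul_left, inner_add_left,
    real_inner_self_eq_norm_sq, hp]
  exact mul_nonneg (inv_nonneg.2 (norm_nonneg _)) (by linarith)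

theorem unpush_push (hw : ‖w‖ < 1) (hp : ‖p‖ = 1) : unpush w (push w p) = p := by
  have hsmul : ‖p + w‖ • push w p = p + w := NormedSpace.norm_smul_normalize _
  have hsq : ⟪push w p, w⟫_ℝ ^ 2 + (1 - ‖w‖ ^ 2) = (‖p + w‖ - ⟪push w p, w⟫_ℝ) ^ 2 := by
    have h := norm_sub_sq_real (‖p + w‖ • push w p) w
    rw [hsmul, add_sub_cancel_right, hp, ← hsmul, real_inner_smul_left, hsmul] at h
    linear_combination h
  have hnonneg : 0 ≤ ‖p + w‖ - ⟪push w p, w⟫_ℝ := by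
    have h : ⟪push w p, p⟫_ℝ = ⟪push w p, ‖p + w‖ • push w p - w⟫_ℝ := by
      rw [hsmul, add_sub_cancel_right]
    rw [inner_sub_right, real_inner_smul_right, real_inner_self_eq_norm_sq, norm_push hw hp,
      one_pow, mul_one] at h
    exact h ▸ inner_push_nonneg hw.le hp
  rw [unpush, hsq, Real.sqrt_sq hnonneg, add_sub_cancel, hsmul, add_sub_cancel_right]

theorem contDiff_unpush (hw : ‖w‖ < 1) : ContDiff ℝ ∞ (unpush w) := by
  have hinner : ContDiff ℝ ∞ fun p : V => ⟪p, w⟫_ℝ := contDiff_id.inner ℝ contDiff_const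
  have hpos : 0 < 1 - ‖w‖ ^ 2 := sub_pos.2 (pow_lt_one₀ (norm_nonneg w) hw two_ne_zero)
  exact ((hinner.add (((hinner.pow 2).add contDiff_const).sqrt fun p => by positivity)).smul
    contDiff_id).sub contDiff_const

theorem contDiffOn_push {X : Type} [NormedAddCommGroup X] [NormedSpace ℝ X] {S : Set X}
    {w p : X → V} (hw : ContDiffOn ℝ ∞ w S) (hp : ContDiffOn ℝ ∞ p S)
    (h : ∀ x ∈ S, p x + w x ≠ 0) : ContDiffOn ℝ ∞ (fun x => push (w x) (p x)) S :=
  (((hp.add hw).norm ℝ h).inv fun x hx => norm_ne_zero_iff.2 (h x hx)).smul (hp.add hw)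

/-- The map of the cotangent bundle over the rigid motion `ρ` that acts on the fibres by
`A ∘ push w`. For `w = 0` and `A` the linear part of `ρ` it extends the action of `ρ` on the unit
cotangent bundle. -/
noncomputable def cotangentPush (ρ : V ≃ᵃⁱ[ℝ] V) (A : V ≃ₗᵢ[ℝ] V) (w : V) (x : V × V) : V × V :=
  (ρ x.1, A (push w x.2))

theorem cotangentPush_mem_unitCotangent (hw : ‖w‖ < 1) (ρ : V ≃ᵃⁱ[ℝ] V) (A : V ≃ₗᵢ[ℝ] V)
    {x : V × V} (hx : x ∈ unitCotangent V) : cotangentPush ρ A w x ∈ unitCotangent V :=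
  (A.norm_map _).trans (norm_push hw hx)

theorem isSmoothEmbeddingOn_cotangentPush (hw : ‖w‖ < 1) (ρ : V ≃ᵃⁱ[ℝ] V) (A : V ≃ₗᵢ[ℝ] V) :
    IsSmoothEmbeddingOn (cotangentPush ρ A w) (unitCotangent V) := by
  have hpush : ContDiffOn ℝ ∞ (fun x : V × V => push w x.2) (unitCotangent V) :=
    contDiffOn_push contDiffOn_const contDiffOn_snd fun x hx => add_ne_zero_of_norm_lt_one hw hx
  refine ⟨(ρ.toAffineIsometry.toContinuousAffineMap.contDiff.comp contDiff_fst).contDiffOn.prodMk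
      (A.contDiff.comp_contDiffOn hpush),
    fun y => (ρ.symm y.1, unpush w (A.symm y.2)), ?_, fun x hx => ?_⟩
  · exact ((ρ.symm.toAffineIsometry.toContinuousAffineMap.contDiff.comp contDiff_fst).prodMk
      ((contDiff_unpush hw).comp (A.symm.contDiff.comp contDiff_snd))).contDiffOn
  · simp only [cotangentPush, AffineIsometryEquiv.symm_apply_apply,
      LinearIsometryEquiv.symm_apply_apply, unpush_push hw hx]

end Push

section Coordinates

/-- The coordinate `z₀`. -/
noncomputable def fstCoord (d : ℕ) : Space d →L[ℝ] EuclideanSpace ℝ (Fin (d - 1)) :=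
  LinearMap.toContinuousLinearMap
    { toFun := fun x => WithLp.toLp 2 fun i => x (Sum.inl i)
      map_add' := fun _ _ => rfl
      map_smul' := fun _ _ => rfl }

/-- The coordinate `z₁`. -/
noncomputable def midCoord (d : ℕ) : Space d →L[ℝ] ℝ :=
  LinearMap.toContinuousLinearMap
    { toFun := fun x => x (Sum.inr (Sum.inl ()))
      map_add' := fun _ _ => rfl
      map_smul' := fun _ _ => rfl }

/-- The coordinate `z₂`. -/
noncomputable def sndCoord (d : ℕ) : Space d →L[ℝ] EuclideanSpace ℝ (Fin (d - 1)) :=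
  LinearMap.toContinuousLinearMap
    { toFun := fun x => WithLp.toLp 2 fun i => x (Sum.inr (Sum.inr i))
      map_add' := fun _ _ => rfl
      map_smul' := fun _ _ => rfl }

variable {d : ℕ} {a a' c c' : EuclideanSpace ℝ (Fin (d - 1))} {b b' : ℝ}

@[simp] theorem fstCoord_point : fstCoord d (point a b c) = a := rfl

@[simp] theorem midCoord_point : midCoord d (point a b c) = b := rfl

@[simp] theorem sndCoord_point : sndCoord d (point a b c) = c := rfl

theorem point_coord (x : Space d) : point (fstCoord d x) (midCoord d x) (sndCoord d x) = x := by
  ext i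
  rcases i with i | i | i <;> rfl

theorem space_ext {x y : Space d} (h0 : fstCoord d x = fstCoord d y)
    (h1 : midCoord d x = midCoord d y) (h2 : sndCoord d x = sndCoord d y) : x = y := by
  rw [← point_coord x, ← point_coord y, h0, h1, h2]

theorem point_zero : (point 0 0 0 : Space d) = 0 := space_ext rfl rfl rfl

theorem point_inj : (point a b c : Space d) = point a' b' c' ↔ a = a' ∧ b = b' ∧ c = c' :=
  ⟨fun h => ⟨congrArg (fstCoord d) h, congrArg (midCoord d) h, congrArg (sndCoord d) h⟩,
    fun ⟨ha, hb, hc⟩ => space_ext ha hb hc⟩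

theorem point_sub_point :
    (point a b c - point a' b' c' : Space d) = point (a - a') (b - b') (c - c') :=
  space_ext (map_sub _ _ _) (map_sub _ _ _) (map_sub _ _ _)

theorem norm_sq_space (x : Space d) :
    ‖x‖ ^ 2 = ‖fstCoord d x‖ ^ 2 + midCoord d x ^ 2 + ‖sndCoord d x‖ ^ 2 := by
  simp only [EuclideanSpace.norm_sq_eq, Fintype.sum_sum_type, Finset.univ_unique,
    Finset.sum_singleton, Real.norm_eq_abs, sq_abs, ← add_assoc]
  rfl

theorem inner_space (x y : Space d) : ⟪x, y⟫_ℝ = ⟪fstCoord d x, fstCoord d y⟫_ℝ +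
    midCoord d x * midCoord d y + ⟪sndCoord d x, sndCoord d y⟫_ℝ := by
  have h := norm_sq_space (x + y)
  simp only [map_add, norm_add_sq_real] at h
  linarith [norm_sq_space x, norm_sq_space y]

theorem norm_point_zero_zero (c : EuclideanSpace ℝ (Fin (d - 1))) :
    ‖(point 0 0 c : Space d)‖ = ‖c‖ :=
  (sq_eq_sq₀ (norm_nonneg _) (norm_nonneg _)).1 (by simp [norm_sq_space])

theorem norm_point_eq_one_iff :
    ‖(point a b c : Space d)‖ = 1 ↔ ‖a‖ ^ 2 + b ^ 2 + ‖c‖ ^ 2 = 1 := by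
  rw [← pow_eq_one_iff_of_nonneg (norm_nonneg _) two_ne_zero, norm_sq_space, fstCoord_point,
    midCoord_point, sndCoord_point]

theorem contDiff_point {X : Type} [NormedAddCommGroup X] [NormedSpace ℝ X]
    {f h : X → EuclideanSpace ℝ (Fin (d - 1))} {g : X → ℝ} (hf : ContDiff ℝ ∞ f)
    (hg : ContDiff ℝ ∞ g) (hh : ContDiff ℝ ∞ h) :
    ContDiff ℝ ∞ fun x => (point (f x) (g x) (h x) : Space d) :=
  contDiff_euclidean.2 fun i => match i with
    | .inl i => contDiff_euclidean.1 hf i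
    | .inr (.inl ()) => hg
    | .inr (.inr i) => contDiff_euclidean.1 hh i

theorem finrank_space : Module.finrank ℝ (Space d) = (d - 1) + (d - 1) + 1 := by
  simp only [finrank_euclideanSpace, Fintype.card_sum, Fintype.card_fin, Fintype.card_unit]
  omega

theorem finrank_ker_of_surjective {f : Space d →ₗ[ℝ] EuclideanSpace ℝ (Fin (d - 1))}
    (hf : Function.Surjective f) : Module.finrank ℝ f.ker = (d - 1) + 1 := by
  have h := f.finrank_range_add_finrank_ker
  rw [LinearMap.range_eq_top.2 hf, finrank_top, finrank_space, finrank_euclideanSpace_fin] at h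
  omega

theorem finrank_ker_fstCoord : Module.finrank ℝ (fstCoord d).ker = (d - 1) + 1 :=
  finrank_ker_of_surjective fun a => ⟨point a 0 0, rfl⟩

theorem finrank_ker_sndCoord : Module.finrank ℝ (sndCoord d).ker = (d - 1) + 1 :=
  finrank_ker_of_surjective fun c => ⟨point 0 0 c, rfl⟩

end Coordinates

section Spheres

variable {d : ℕ} {a c z : EuclideanSpace ℝ (Fin (d - 1))} {b : ℝ}

theorem point_mem_K₁_iff : point a b c ∈ K₁ d ↔ a = 0 ∧ (b - 1) ^ 2 + ‖c‖ ^ 2 = 1 := by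
  constructor
  · rintro ⟨z₁, z₂, h, hx⟩
    obtain ⟨rfl, rfl, rfl⟩ := point_inj.1 hx
    exact ⟨rfl, by rwa [add_sub_cancel_right]⟩
  · rintro ⟨rfl, h⟩
    exact ⟨b - 1, c, h, by rw [sub_add_cancel]⟩

theorem point_mem_K₂_iff : point a b c ∈ K₂ d z ↔ ‖a‖ ^ 2 + b ^ 2 = 1 ∧ c = z := by
  constructor
  · rintro ⟨z₀, z₁, h, hx⟩
    obtain ⟨rfl, rfl, rfl⟩ := point_inj.1 hx
    exact ⟨h, rfl⟩
  · rintro ⟨h, rfl⟩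
    exact ⟨a, b, h, rfl⟩

theorem point_mem_K₀_iff : point a b c ∈ K₀ d ↔ ‖a‖ ^ 2 + b ^ 2 = 1 ∧ c = 0 :=
  point_mem_K₂_iff (z := 0)

theorem K₁_eq_roundSphere : K₁ d = roundSphere (point 0 1 0) (fstCoord d).ker := by
  ext x
  rw [← point_coord x, point_mem_K₁_iff, roundSphere, mem_ofPred_eq, point_sub_point,
    norm_point_eq_one_iff, LinearMap.mem_ker, ContinuousLinearMap.coe_coe, fstCoord_point, sub_zero,
    sub_zero]
  exact and_congr_right fun h => by rw [h, norm_zero, zero_pow two_ne_zero, zero_add]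

theorem K₂_eq_roundSphere : K₂ d z = roundSphere (point 0 0 z) (sndCoord d).ker := by
  ext x
  rw [← point_coord x, point_mem_K₂_iff, roundSphere, mem_ofPred_eq, point_sub_point,
    norm_point_eq_one_iff, LinearMap.mem_ker, ContinuousLinearMap.coe_coe, sndCoord_point, sub_zero,
    sub_zero, sub_eq_zero, and_comm]
  exact and_congr_right fun h => by rw [h, sub_self, norm_zero, zero_pow two_ne_zero, add_zero]

theorem K₀_eq_roundSphere : K₀ d = roundSphere (point 0 0 0) (sndCoord d).ker :=
  K₂_eq_roundSphere (z := 0)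

theorem disjoint_K₀_K₁ : Disjoint (K₀ d) (K₁ d) := by
  refine disjoint_left.2 fun x h₀ h₁ => ?_
  rw [← point_coord x] at h₀ h₁
  obtain ⟨h₀, hc⟩ := point_mem_K₀_iff.1 h₀
  obtain ⟨ha, h₁⟩ := point_mem_K₁_iff.1 h₁
  rw [ha, norm_zero] at h₀
  rw [hc, norm_zero] at h₁
  nlinarith

theorem disjoint_K₀_K₂ (hz : z ≠ 0) : Disjoint (K₀ d) (K₂ d z) := by
  refine disjoint_left.2 fun x h₀ h₂ => hz ?_
  rw [← point_coord x] at h₀ h₂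
  exact (point_mem_K₂_iff.1 h₂).2.symm.trans (point_mem_K₀_iff.1 h₀).2

theorem isSphereUnion_K₀_union_K₁ : IsSphereUnion (d - 1 + 1) (K₀ d ∪ K₁ d) := by
  have h := disjoint_K₀_K₁ (d := d)
  rw [K₀_eq_roundSphere, K₁_eq_roundSphere] at h ⊢
  exact isSphereUnion_union finrank_ker_sndCoord finrank_ker_fstCoord h

theorem isSphereUnion_K₀_union_K₂ (hz : z ≠ 0) :
    IsSphereUnion (d - 1 + 1) (K₀ d ∪ K₂ d z) := by
  have h := disjoint_K₀_K₂ hz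
  rw [K₀_eq_roundSphere, K₂_eq_roundSphere] at h ⊢
  exact isSphereUnion_union finrank_ker_sndCoord finrank_ker_sndCoord h

variable {x : Space d × Space d}

theorem sndCoord_eq_zero_of_mem_conormal_K₁ (hx : x ∈ conormal (K₁ d))
    (h : sndCoord d x.1 = 0) : sndCoord d x.2 = 0 := by
  rw [K₁_eq_roundSphere] at hx
  have hv : point 0 0 (sndCoord d x.2) ∈
      tangentSpace (roundSphere (point 0 1 0) (fstCoord d).ker) x.1 :=
    (mem_tangentSpace_roundSphere_iff hx.1).2 ⟨rfl, by simp [inner_space, h]⟩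
  simpa [inner_space] using hx.2 _ hv

theorem fstCoord_eq_zero_of_mem_conormal_K₀ (hx : x ∈ conormal (K₀ d))
    (h : fstCoord d x.1 = 0) : fstCoord d x.2 = 0 := by
  rw [K₀_eq_roundSphere] at hx
  have hv : point (fstCoord d x.2) 0 0 ∈
      tangentSpace (roundSphere (point 0 0 0) (sndCoord d).ker) x.1 :=
    (mem_tangentSpace_roundSphere_iff hx.1).2 ⟨rfl, by simp [inner_space, h]⟩
  simpa [inner_space] using hx.2 _ hv

end Spheres

section Rotation

variable {d : ℕ}

theorem sin_sq_add_cos_sq_smul {W : Type} [AddCommGroup W] [Module ℝ W] (θ : ℝ) (v : W) :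
    (Real.sin θ ^ 2 + Real.cos θ ^ 2) • v = v := by
  rw [Real.sin_sq_add_cos_sq, one_smul]

/-- The rotation by the angle `θ` that moves `z₀` towards `z₂` and fixes `z₁`. -/
noncomputable def rotation (θ : ℝ) : Space d ≃ₗᵢ[ℝ] Space d where
  toFun x := point (Real.cos θ • fstCoord d x - Real.sin θ • sndCoord d x) (midCoord d x)
    (Real.sin θ • fstCoord d x + Real.cos θ • sndCoord d x)
  map_add' x y := by
    refine space_ext ?_ (by simp) ?_ <;> simp only [fstCoord_point, sndCoord_point, map_add] <;>
      module
  map_smul' r x := by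
    refine space_ext ?_ (by simp) ?_ <;>
      simp only [fstCoord_point, sndCoord_point, map_smul, RingHom.id_apply] <;> module
  invFun x := point (Real.cos θ • fstCoord d x + Real.sin θ • sndCoord d x) (midCoord d x)
    (Real.cos θ • sndCoord d x - Real.sin θ • fstCoord d x)
  left_inv x := by
    refine space_ext ?_ rfl ?_ <;> simp only [fstCoord_point, sndCoord_point]
    · exact .trans (by module) (sin_sq_add_cos_sq_smul θ (fstCoord d x))
    · exact .trans (by module) (sin_sq_add_cos_sq_smul θ (sndCoord d x))
  right_inv x := by
    refine space_ext ?_ rfl ?_ <;> simp only [fstCoord_point, sndCoord_point]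
    · exact .trans (by module) (sin_sq_add_cos_sq_smul θ (fstCoord d x))
    · exact .trans (by module) (sin_sq_add_cos_sq_smul θ (sndCoord d x))
  norm_map' x := by
    refine (sq_eq_sq₀ (norm_nonneg _) (norm_nonneg _)).1 ?_
    simp only [LinearEquiv.coe_mk, LinearMap.coe_mk, AddHom.coe_mk, norm_sq_space, fstCoord_point,
      norm_sub_sq_real, norm_smul, Real.norm_eq_abs, mul_pow, sq_abs, inner_smul_right,
      inner_smul_left, Real.ringHom_apply, midCoord_point, sndCoord_point, norm_add_sq_real]
    linear_combination (‖fstCoord d x‖ ^ 2 + ‖sndCoord d x‖ ^ 2) * Real.sin_sq_add_cos_sq θ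

theorem rotation_apply (θ : ℝ) (x : Space d) : rotation θ x =
    point (Real.cos θ • fstCoord d x - Real.sin θ • sndCoord d x) (midCoord d x)
      (Real.sin θ • fstCoord d x + Real.cos θ • sndCoord d x) := rfl

theorem rotation_zero : (rotation 0 : Space d ≃ₗᵢ[ℝ] Space d) = .refl ℝ (Space d) := by
  ext1 x
  simp [rotation_apply, point_coord]

theorem contDiffOn_rotation {X : Type} [NormedAddCommGroup X] [NormedSpace ℝ X] {S : Set X}
    {θ : X → ℝ} {f : X → Space d} (hθ : ContDiff ℝ ∞ θ) (hf : ContDiffOn ℝ ∞ f S) :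
    ContDiffOn ℝ ∞ (fun x => rotation (θ x) (f x)) S := by
  have h : ContDiff ℝ ∞ fun y : ℝ × Space d => rotation y.1 y.2 := by
    simp only [rotation_apply]
    exact contDiff_point (by fun_prop) (by fun_prop) (by fun_prop)
  simpa only [Function.comp_def] using h.comp_contDiffOn (hθ.contDiffOn.prodMk hf)

/-- The rigid motion that rotates about the centre of `K₁` and moves this centre to `p`. -/
noncomputable def linkMotion (θ : ℝ) (p : Space d) : Space d ≃ᵃⁱ[ℝ] Space d :=
  ((AffineIsometryEquiv.vaddConst ℝ (point 0 1 0 : Space d)).symm.trans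
    (rotation θ).toAffineIsometryEquiv).trans (AffineIsometryEquiv.vaddConst ℝ p)

theorem linkMotion_apply (θ : ℝ) (p q : Space d) :
    linkMotion θ p q = rotation θ (q - point 0 1 0) + p := rfl

theorem contDiff_linkMotion {X : Type} [NormedAddCommGroup X] [NormedSpace ℝ X]
    {θ : X → ℝ} {p f : X → Space d} (hθ : ContDiff ℝ ∞ θ) (hp : ContDiff ℝ ∞ p)
    (hf : ContDiff ℝ ∞ f) : ContDiff ℝ ∞ fun x => linkMotion (θ x) (p x) (f x) :=
  (contDiffOn_univ.1 (contDiffOn_rotation hθ (hf.sub contDiff_const).contDiffOn)).add hp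

end Rotation

section Link

variable {d : ℕ} {z : EuclideanSpace ℝ (Fin (d - 1))}

theorem linkMotion_point (θ b z₁ : ℝ) (c z₂ : EuclideanSpace ℝ (Fin (d - 1))) :
    linkMotion θ (point 0 b c) (point 0 (z₁ + 1) z₂ : Space d) =
      point (-Real.sin θ • z₂) (b + z₁) (c + Real.cos θ • z₂) := by
  refine space_ext ?_ ?_ ?_ <;>
    simp [linkMotion_apply, rotation_apply, point_sub_point, add_comm]

theorem linkMotion_zero : linkMotion 0 (point 0 1 0 : Space d) = .refl ℝ (Space d) := by
  ext1 q
  rw [linkMotion_apply, rotation_zero]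
  exact sub_add_cancel q _

theorem linkMotion_image_K₁ (z : EuclideanSpace ℝ (Fin (d - 1))) :
    linkMotion (Real.pi / 2) (point 0 0 z) '' K₁ d = K₂ d z := by
  have h (z₁ : ℝ) (z₂ : EuclideanSpace ℝ (Fin (d - 1))) :
      linkMotion (Real.pi / 2) (point 0 0 z) (point 0 (z₁ + 1) z₂ : Space d) =
        point (-z₂) z₁ z := by
    simp [linkMotion_point]
  ext q
  constructor
  · rintro ⟨_, ⟨z₁, z₂, hz, rfl⟩, rfl⟩
    exact ⟨-z₂, z₁, by rw [norm_neg, add_comm, hz], h z₁ z₂⟩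
  · rintro ⟨z₀, z₁, hz, rfl⟩
    exact ⟨_, ⟨z₁, -z₀, by rw [norm_neg, add_comm, hz], rfl⟩, by rw [h, neg_neg]⟩

theorem isoOver_linkMotion {k : ℕ} {σ : FrameCover.{u} (Space d) (k + 1)}
    (hσ : IsSpinStructure (univ : Set (Space d)) σ) (θ : ℝ) (p : Space d) :
    σ.IsoOver σ (rigidFrameHomeomorph (linkMotion θ p) (k + 1)) := by
  have hsmooth : ContDiff ℝ ∞ fun y : ℝ × Space d =>
      linkMotion (y.1 * θ) (AffineMap.lineMap (point 0 1 0) p y.1) y.2 :=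
    contDiff_linkMotion (by fun_prop) (by simp only [AffineMap.lineMap_apply_module]; fun_prop)
      contDiff_snd
  have hcont : Continuous fun y : unitInterval × Space d =>
      linkMotion (y.1 * θ) (AffineMap.lineMap (point 0 1 0) p (y.1 : ℝ)) y.2 := by
    simpa only [Function.comp_def] using hsmooth.continuous.comp
      (f := fun y : unitInterval × Space d => ((y.1 : ℝ), y.2)) (by fun_prop)
  have h := hσ.isoOver_of_rigidIsotopy
    (fun s => linkMotion (s * θ) (AffineMap.lineMap (point 0 1 0) p (s : ℝ)))
    hcont (by simp [linkMotion_zero])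
  simpa using h

theorem linkMotion_notMem_K₀_of_mid {q : Space d} (hq : q ∈ K₁ d) (θ : ℝ)
    (c : EuclideanSpace ℝ (Fin (d - 1))) : linkMotion θ (point 0 3 c) q ∉ K₀ d := by
  obtain ⟨z₁, z₂, hz, rfl⟩ := hq
  rw [linkMotion_point, point_mem_K₀_iff]
  rintro ⟨h, -⟩
  nlinarith [sq_nonneg ‖z₂‖, sq_nonneg ‖-Real.sin θ • z₂‖]

theorem linkMotion_notMem_K₀_of_snd {q : Space d} (hq : q ∈ K₁ d) (b : ℝ) (hz : z ≠ 0) :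
    linkMotion (Real.pi / 2) (point 0 b z) q ∉ K₀ d := by
  obtain ⟨z₁, z₂, -, rfl⟩ := hq
  rw [linkMotion_point, point_mem_K₀_iff]
  rintro ⟨-, h⟩
  exact hz (by simpa using h)

theorem cotangentPush_notMem_unitConormal_K₀ (b : ℝ) {c : EuclideanSpace ℝ (Fin (d - 1))}
    (hc : c ≠ 0) (hc1 : ‖c‖ < 1) {x : Space d × Space d} (hx : x ∈ unitConormal (K₁ d)) :
    cotangentPush (linkMotion 0 (point 0 b 0)) (rotation (Real.pi / 2)) (point 0 0 c) x ∉
      unitConormal (K₀ d) := by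
  intro hy
  obtain ⟨z₁, z₂, -, hq⟩ := hx.1.1
  have hq' : linkMotion 0 (point 0 b 0) x.1 = point 0 (b + z₁) z₂ := by
    simp [hq, linkMotion_point]
  have hmem : linkMotion 0 (point 0 b 0) x.1 ∈ K₀ d := hy.1.1
  rw [hq', point_mem_K₀_iff] at hmem
  obtain rfl := hmem.2
  have hp : sndCoord d x.2 = 0 := sndCoord_eq_zero_of_mem_conormal_K₁ hx.1 (by rw [hq]; rfl)
  have hne : x.2 + point 0 0 c ≠ 0 :=
    add_ne_zero_of_norm_lt_one ((norm_point_zero_zero c).trans_lt hc1) hx.2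
  have h := fstCoord_eq_zero_of_mem_conormal_K₀ hy.1 (congrArg (fstCoord d) hq')
  simp [cotangentPush, rotation_apply, push, NormedSpace.normalize, hp, hc, hne] at h

/-- A smooth step from `0` to `1` during the `i`-th quarter of the unit interval, counted
from `0`. -/
noncomputable def quarterStep (i s : ℝ) : ℝ := Real.smoothTransition (4 * s - i)

variable {i s : ℝ}

theorem quarterStep_eq_zero (h : 4 * s ≤ i) : quarterStep i s = 0 :=
  Real.smoothTransition.zero_of_nonpos (sub_nonpos.2 h)

theorem quarterStep_eq_one (h : i + 1 ≤ 4 * s) : quarterStep i s = 1 :=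
  Real.smoothTransition.one_of_one_le (by linarith)

theorem contDiff_quarterStep (i : ℝ) : ContDiff ℝ ∞ (quarterStep i) :=
  Real.smoothTransition.contDiff.comp ((contDiff_const.mul contDiff_id).sub contDiff_const)

/-- The direction in which the covectors are pushed at the time `s` of the unlinking isotopy. -/
noncomputable def unlinkPush (z : EuclideanSpace ℝ (Fin (d - 1))) (s : ℝ) :
    EuclideanSpace ℝ (Fin (d - 1)) :=
  (quarterStep 0 s - quarterStep 2 s) • (1 + ‖z‖)⁻¹ • z

theorem norm_unlinkPush_lt_one (z : EuclideanSpace ℝ (Fin (d - 1))) (s : ℝ) :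
    ‖(point 0 0 (unlinkPush z s) : Space d)‖ < 1 := by
  have ht : |quarterStep 0 s - quarterStep 2 s| ≤ 1 :=
    abs_sub_le_of_nonneg_of_le (Real.smoothTransition.nonneg _) (Real.smoothTransition.le_one _)
      (Real.smoothTransition.nonneg _) (Real.smoothTransition.le_one _)
  have hz : ‖(1 + ‖z‖)⁻¹ • z‖ < 1 := by
    rw [norm_smul, norm_inv, Real.norm_of_nonneg (by positivity), ← div_eq_inv_mul,
      div_lt_one (by positivity)]
    exact lt_one_add _
  rw [norm_point_zero_zero, unlinkPush, norm_smul]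
  exact (mul_le_of_le_one_left (norm_nonneg _) ht).trans_lt hz

/-- The rigid motion of `K₁` at the time `s` of the unlinking isotopy. -/
noncomputable def unlinkMotion (z : EuclideanSpace ℝ (Fin (d - 1))) (s : ℝ) :
    Space d ≃ᵃⁱ[ℝ] Space d :=
  linkMotion (Real.pi / 2 * quarterStep 2 s)
    (point 0 (1 + 2 * quarterStep 1 s - 3 * quarterStep 3 s) (quarterStep 2 s • z))

/-- The isotopy that carries the unit conormal bundle of `K₁` to that of `K₂` in the complement
of the unit conormal bundle of `K₀`. In the four quarters of the unit interval, the covectors are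
rotated by a right angle and pushed towards `z`; the sphere is moved through `K₀` away from it; it
is rotated and moved to the height of `z` while the push is undone; it is moved to `K₂`. -/
noncomputable def unlink (z : EuclideanSpace ℝ (Fin (d - 1))) (s : ℝ) :
    Space d × Space d → Space d × Space d :=
  cotangentPush (unlinkMotion z s) (rotation (Real.pi / 2 * quarterStep 0 s))
    (point 0 0 (unlinkPush z s))

theorem unlink_zero {x : Space d × Space d} (hx : x ∈ unitCotangent (Space d)) :
    unlink z 0 x = x := by
  have h {i : ℝ} (hi : 0 ≤ i) : quarterStep i 0 = 0 := quarterStep_eq_zero (by simpa using hi)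
  have hmotion : unlinkMotion z 0 = .refl ℝ (Space d) := by
    rw [unlinkMotion, h zero_le_two, h zero_le_one, h zero_le_three, mul_zero, mul_zero, mul_zero,
      add_zero, sub_zero, zero_smul, linkMotion_zero]
  have hpush : unlinkPush z 0 = 0 := by
    rw [unlinkPush, h le_rfl, h zero_le_two, sub_zero, zero_smul]
  rw [unlink, hmotion, hpush, h le_rfl, mul_zero, rotation_zero, point_zero]
  exact Prod.ext rfl (push_zero hx)

theorem unlink_one {x : Space d × Space d} (hx : x ∈ unitCotangent (Space d)) :
    unlink z 1 x = cotangentLift (linkMotion (Real.pi / 2) (point 0 0 z)) x := by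
  have h {i : ℝ} (hi : i ≤ 3) : quarterStep i 1 = 1 := quarterStep_eq_one (by linarith)
  have hmotion : unlinkMotion z 1 = linkMotion (Real.pi / 2) (point 0 0 z) := by
    rw [unlinkMotion, h (by norm_num), h (by norm_num), h le_rfl, mul_one, mul_one, mul_one,
      one_smul, show (1 : ℝ) + 2 - 3 = 0 by norm_num]
  have hpush : unlinkPush z 1 = 0 := by
    rw [unlinkPush, h zero_le_three, h (by norm_num), sub_self, zero_smul]
  rw [unlink, hmotion, hpush, h zero_le_three, mul_one, point_zero, cotangentPush, push_zero hx]
  rfl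

theorem contDiffOn_unlink (z : EuclideanSpace ℝ (Fin (d - 1))) :
    ContDiffOn ℝ ∞ (Function.uncurry (unlink z)) (univ ×ˢ unitCotangent (Space d)) := by
  have ht (i : ℝ) : ContDiff ℝ ∞ fun y : ℝ × (Space d × Space d) => quarterStep i y.1 :=
    (contDiff_quarterStep i).comp contDiff_fst
  have hmotion : ContDiff ℝ ∞ fun y : ℝ × (Space d × Space d) => unlinkMotion z y.1 y.2.1 :=
    contDiff_linkMotion (by fun_prop) (contDiff_point (by fun_prop) (by fun_prop) (by fun_prop))
      (by fun_prop)
  have hpush : ContDiffOn ℝ ∞ (fun y : ℝ × (Space d × Space d) =>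
      push (point 0 0 (unlinkPush z y.1)) y.2.2) (univ ×ˢ unitCotangent (Space d)) :=
    contDiffOn_push
      (contDiff_point contDiff_const contDiff_const
        (((ht 0).sub (ht 2)).smul contDiff_const)).contDiffOn
      contDiff_snd.snd.contDiffOn
      fun y hy => add_ne_zero_of_norm_lt_one (norm_unlinkPush_lt_one z y.1) hy.2
  exact hmotion.contDiffOn.prodMk (contDiffOn_rotation (by fun_prop) hpush)

theorem unlinkMotion_notMem_K₀ (hz : z ≠ 0) {q : Space d} (hq : q ∈ K₁ d)
    (hs : s ≤ 1 / 4 ∨ 1 / 2 ≤ s) : unlinkMotion z s q ∉ K₀ d := by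
  rcases hs with hs | hs
  · rw [unlinkMotion, quarterStep_eq_zero (i := 1) (by linarith),
      quarterStep_eq_zero (i := 2) (by linarith), quarterStep_eq_zero (i := 3) (by linarith)]
    simpa [linkMotion_zero] using disjoint_right.1 disjoint_K₀_K₁ hq
  rcases le_total s (3 / 4) with hs' | hs'
  · rw [unlinkMotion, quarterStep_eq_one (i := 1) (by linarith),
      quarterStep_eq_zero (i := 3) (by linarith), mul_zero, sub_zero, mul_one,
      show (1 : ℝ) + 2 = 3 by norm_num]
    exact linkMotion_notMem_K₀_of_mid hq _ _
  · rw [unlinkMotion, quarterStep_eq_one (i := 2) (by linarith), one_smul, mul_one]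
    exact linkMotion_notMem_K₀_of_snd hq _ hz

theorem unlink_notMem_unitConormal_K₀ (hz : z ≠ 0) (s : ℝ) {x : Space d × Space d}
    (hx : x ∈ unitConormal (K₁ d)) : unlink z s x ∉ unitConormal (K₀ d) := by
  by_cases hs : s ≤ 1 / 4 ∨ 1 / 2 ≤ s
  · exact fun hy => unlinkMotion_notMem_K₀ hz hx.1.1 hs hy.1.1
  rw [not_or, not_le, not_le] at hs
  have hstart : quarterStep 0 s = 1 := quarterStep_eq_one (by linarith [hs.1])
  have hend : quarterStep 2 s = 0 := quarterStep_eq_zero (by linarith [hs.2])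
  have hpush : unlinkPush z s ≠ 0 := by
    rw [unlinkPush, hstart, hend, sub_zero, one_smul]
    exact smul_ne_zero (by positivity) hz
  rw [unlink, unlinkMotion, hstart, hend, mul_zero, mul_one, zero_smul]
  exact cotangentPush_notMem_unitConormal_K₀ _ hpush
    ((norm_point_zero_zero _).symm.trans_lt (norm_unlinkPush_lt_one z s)) hx

theorem isIsotopyIn_unlink (z : EuclideanSpace ℝ (Fin (d - 1))) :
    IsIsotopyIn (unitCotangent (Space d)) (unitConormal (K₁ d)) (unlink z) where
  contDiffOn := (contDiffOn_unlink z).mono (prod_mono (subset_univ _) inter_subset_right)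
  isSmoothEmbeddingOn s _ :=
    (isSmoothEmbeddingOn_cotangentPush (norm_unlinkPush_lt_one z s) _ _).mono inter_subset_right
  mapsTo s _ _ hx := cotangentPush_mem_unitCotangent (norm_unlinkPush_lt_one z s) _ _ hx.2
  zero _ hx := unlink_zero hx.2

theorem spinIsotopic_link {k : ℕ} (hz : z ≠ 0) {σ : FrameCover.{u} (Space d) (k + 1)}
    (hσ : IsSpinStructure (univ : Set (Space d)) σ) :
    SpinIsotopic (unitCotangent (Space d))
      (unitConormal (K₀ d ∪ K₁ d)) (unitConormal (K₀ d ∪ K₂ d z))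
      (unitConormalCover σ (K₀ d ∪ K₁ d)) (unitConormalCover σ (K₀ d ∪ K₂ d z)) := by
  have hdisj := disjoint_K₀_K₂ hz
  rw [← linkMotion_image_K₁] at hdisj ⊢
  refine spinIsotopic_of_isIsotopyIn ?_ ?_ ?_ ?_ disjoint_K₀_K₁ hdisj (isoOver_linkMotion hσ _ _)
    (isIsotopyIn_unlink z) (fun s _ x hx => unlink_notMem_unitConormal_K₀ hz s hx)
    fun x hx => unlink_one hx.2
  · exact K₀_eq_roundSphere ▸ isClosed_roundSphere _ _
  · exact K₁_eq_roundSphere ▸ isClosed_roundSphere _ _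
  · exact K₀_eq_roundSphere ▸ isCompact_unitConormal_roundSphere _ _
  · exact K₁_eq_roundSphere ▸ isCompact_unitConormal_roundSphere _ _

end Link

end ConormalSpin

theorem mainTheorem6 (d : ℕ) (hd : 2 ≤ d) (z : EuclideanSpace ℝ (Fin (d - 1))) (hz : z ≠ 0)
    (σ : FrameCover.{u} (Space d) (2 * d - 2 + 1))
    (hσ : IsSpinStructure (Set.univ : Set (Space d)) σ) :
    IsSmoothSubmanifold (2 * d - 2) (unitConormal (K₀ d ∪ K₁ d)) ∧
    IsSmoothSubmanifold (2 * d - 2) (unitConormal (K₀ d ∪ K₂ d z)) ∧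
    IsSpinStructure (unitConormal (K₀ d ∪ K₁ d)) (unitConormalCover σ (K₀ d ∪ K₁ d)) ∧
    IsSpinStructure (unitConormal (K₀ d ∪ K₂ d z)) (unitConormalCover σ (K₀ d ∪ K₂ d z)) ∧
    SpinIsotopic (unitCotangent (Space d))
      (unitConormal (K₀ d ∪ K₁ d)) (unitConormal (K₀ d ∪ K₂ d z))
      (unitConormalCover σ (K₀ d ∪ K₁ d)) (unitConormalCover σ (K₀ d ∪ K₂ d z)) := by
  have hdim : 2 * d - 2 = d - 1 + (d - 1) := by omega
  have hV : Module.finrank ℝ (Space d) = 2 * d - 2 + 1 := by rw [finrank_space, hdim]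
  have h₁ : IsSphereUnion (d - 1 + 1) (K₀ d ∪ K₁ d) := isSphereUnion_K₀_union_K₁
  have h₂ : IsSphereUnion (d - 1 + 1) (K₀ d ∪ K₂ d z) := isSphereUnion_K₀_union_K₂ hz
  refine ⟨?_, ?_, h₁.isSpinStructure_unitConormalCover hV hσ,
    h₂.isSpinStructure_unitConormalCover hV hσ, spinIsotopic_link hz hσ⟩
  · exact hdim ▸ h₁.isSmoothSubmanifold_unitConormal finrank_space
  · exact hdim ▸ h₂.isSmoothSubmanifold_unitConormal finrank_space
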